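/- Let $p>1$. There is a constant $C>0$ depending only on $p$ such that the following holds. On $\mathbb{R}^{1+2}$ with coordinates $(x^0,x^1,x^2)=(t,x_1,x_2)$ and Minkowski metric $m=\mathrm{diag}(-1,1,1)$ (used to raise and lower indices), let $\phi$ be a complex-valued $C^2$ function and $A=(A_0,A_1,A_2)$ a real 1-form of class $C^1$ on $[0,\infty)\times\mathbb{R}^2$, and put $D_\mu=\partial_\mu+iA_\mu$, $F_{\mu\nu}=\partial_\mu A_\nu-\partial_\nu A_\mu$, $J_\gamma=\operatorname{Im}(\phi\,\overline{D_\gamma\phi})$. Assume that $(\phi,A)$ solves the Chern–Simons–Higgs system with defocusing power nonlinearity $$D^\mu D_\mu\phi=|\phi|^{p-1}\phi,\qquad F_{\mu\nu}=\varepsilon_{\mu\nu\gamma}J^\gamma\qquad\text{for } t\ge 0,\ x\in\mathbb{R}^2,$$ with $\phi(0,x)=\phi_0(x)$ and $D_0\phi(0,x)=\phi_1(x)$, where $\varepsilon_{\mu\nu\gamma}$ is totally antisymmetric with $\varepsilon_{012}=1$. Assume that the initial conformal energy $$\mathcal{E}_{0,2}=\int_{\mathbb{R}^2}(1+|x|)^2\big(|D_1\phi_0|^2+|D_2\phi_0|^2+|\phi_1|^2\big)+(1+|x|)^2|\phi_0|^{p+1}\,dx$$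 is finite, where $D_1,D_2$ are taken with the connection $A$ at $t=0$. Then for all $t\ge 0$ $$\int_{\mathbb{R}^2}|\phi(t,x)|^{p+1}(1+t+|x|)^{\min\{\frac{p-1}{2},\,2\}}\,dx\le C\,\mathcal{E}_{0,2},$$ and in particular $$\int_{\mathbb{R}^2}|\phi(t,x)|^{p+1}\,dx\le C\,\mathcal{E}_{0,2}\,(1+t)^{-\min\{\frac{p-1}{2},\,2\}}.$$ -/

import Mathlib

open MeasureTheory
open scoped ENNReal

namespace ChernSimonsHiggs

/-- Spacetime `ℝ^{1+2}` with coordinates `z 0 = t`, `z 1 = x₁`, `z 2 = x₂`. -/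
abbrev Spacetime : Type := Fin 3 → ℝ

/-- Space `ℝ²` with its Euclidean norm and Lebesgue measure. -/
abbrev Space : Type := EuclideanSpace ℝ (Fin 2)

/-- The spacetime point `(t, x)`. -/
def event (t : ℝ) (x : Space) : Spacetime := ![t, x 0, x 1]

/-- The Minkowski metric `m = diag(-1, 1, 1)`. It is its own inverse, so it both raises and lowers
indices. -/
def mink : Matrix (Fin 3) (Fin 3) ℝ := Matrix.diagonal ![-1, 1, 1]

theorem mink_mul_mink : mink * mink = 1 := by
  unfold mink
  rw [Matrix.diagonal_mul_diagonal, ← Matrix.diagonal_one]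
  congr 1
  ext i
  fin_cases i <;> simp

/-- The totally antisymmetric symbol `ε_{μνγ}` with `ε_{012} = 1`, by the Vandermonde formula. -/
noncomputable def eps (μ ν γ : Fin 3) : ℝ :=
  (((ν : ℕ) : ℝ) - ((μ : ℕ) : ℝ)) * (((γ : ℕ) : ℝ) - ((μ : ℕ) : ℝ)) *
    (((γ : ℕ) : ℝ) - ((ν : ℕ) : ℝ)) / 2

theorem eps_zero_one_two : eps 0 1 2 = 1 := by
  norm_num [eps]

theorem eps_swap_left (μ ν γ : Fin 3) : eps ν μ γ = -eps μ ν γ := by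
  unfold eps; ring

theorem eps_swap_right (μ ν γ : Fin 3) : eps μ γ ν = -eps μ ν γ := by
  unfold eps; ring

/-- The coordinate derivative `∂_μ f` at the spacetime point `z`. -/
noncomputable def pd {E : Type*} [NormedAddCommGroup E] [NormedSpace ℝ E]
    (μ : Fin 3) (f : Spacetime → E) (z : Spacetime) : E :=
  fderiv ℝ f z (Pi.single μ 1)

/-- The covariant derivative `D_μ f = ∂_μ f + i A_μ f` of a complex field, for the real 1-form `A`
with components `A μ`. -/
noncomputable def covD (A : Fin 3 → Spacetime → ℝ) (μ : Fin 3) (f : Spacetime → ℂ)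
    (z : Spacetime) : ℂ :=
  pd μ f z + Complex.I * (A μ z : ℂ) * f z

/-- The curvature `F_{μν} = ∂_μ A_ν - ∂_ν A_μ`. -/
noncomputable def curvature (A : Fin 3 → Spacetime → ℝ) (μ ν : Fin 3) (z : Spacetime) : ℝ :=
  pd μ (A ν) z - pd ν (A μ) z

/-- The current `J_γ[φ] = Im (φ * conj (D_γ φ))`. -/
noncomputable def current (A : Fin 3 → Spacetime → ℝ) (φ : Spacetime → ℂ) (γ : Fin 3)
    (z : Spacetime) : ℝ :=
  (φ z * (starRingEnd ℂ) (covD A γ φ z)).im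

/-- The current with raised index, `J^γ = m^{γβ} J_β`. -/
noncomputable def currentUp (A : Fin 3 → Spacetime → ℝ) (φ : Spacetime → ℂ) (γ : Fin 3)
    (z : Spacetime) : ℝ :=
  ∑ β, mink γ β * current A φ β z

/-- The covariant wave operator `□_A φ = D^μ D_μ φ = m^{μν} D_μ D_ν φ`. -/
noncomputable def boxA (A : Fin 3 → Spacetime → ℝ) (φ : Spacetime → ℂ) (z : Spacetime) : ℂ :=
  ∑ μ, ∑ ν, (mink μ ν : ℂ) * covD A μ (covD A ν φ) z

/-- `(φ, A)` is a classical solution on `[0, ∞) × ℝ²` of the Chern–Simons–Higgs system with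
nonlinearity `|φ|^{p-1} φ` and initial data `(φ₀, φ₁)`.

`φ` is `C²` and `A` is `C¹` up to the initial time. Functions of class `C^k` on the closed half-space
`t ≥ 0` are restrictions of `C^k` functions on the whole space, and all derivatives below at
points with `t ≥ 0` are determined by the values on `t ≥ 0`; so `φ` and `A` are taken to be
(arbitrarily extended) functions on `ℝ^{1+2}`, and the equations are imposed for `t ≥ 0` only. -/
structure IsSolution (p : ℝ) (φ₀ φ₁ : Space → ℂ) (φ : Spacetime → ℂ)
    (A : Fin 3 → Spacetime → ℝ) : Prop where
  contDiff_field : ContDiff ℝ 2 φ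
  contDiff_connection : ∀ μ, ContDiff ℝ 1 (A μ)
  wave_eq : ∀ z : Spacetime, 0 ≤ z 0 → boxA A φ z = ((‖φ z‖ ^ (p - 1) : ℝ) : ℂ) * φ z
  curvature_eq : ∀ z : Spacetime, 0 ≤ z 0 → ∀ μ ν : Fin 3,
    curvature A μ ν z = ∑ γ, eps μ ν γ * currentUp A φ γ z
  initial_field : ∀ x : Space, φ (event 0 x) = φ₀ x
  initial_velocity : ∀ x : Space, covD A 0 φ (event 0 x) = φ₁ x

/-- The spatial part `(A₁, A₂)` of the connection on the initial hypersurface `t = 0`. -/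
def initialConnection (A : Fin 3 → Spacetime → ℝ) (j : Fin 2) (x : Space) : ℝ :=
  A j.succ (event 0 x)

/-- The spatial covariant derivative `D_{j+1} f = ∂_{j+1} f + i a_{j+1} f` on `ℝ²`, the indices
`j = 0, 1` standing for the directions `x₁, x₂`. -/
noncomputable def spaceCovD (a : Fin 2 → Space → ℝ) (j : Fin 2) (f : Space → ℂ) (x : Space) : ℂ :=
  fderiv ℝ f x (EuclideanSpace.single j 1) + Complex.I * (a j x : ℂ) * f x

/-- The initial conformal energy
`E_{0,2} = ∫ (1+|x|)² (|D̄φ₀|² + |φ₁|²) + (1+|x|)² |φ₀|^{p+1} dx ∈ [0, ∞]`. -/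
noncomputable def conformalEnergy (p : ℝ) (a : Fin 2 → Space → ℝ) (φ₀ φ₁ : Space → ℂ) : ℝ≥0∞ :=
  ∫⁻ x : Space, ENNReal.ofReal
    ((1 + ‖x‖) ^ 2 * ((∑ j, ‖spaceCovD a j φ₀ x‖ ^ 2) + ‖φ₁ x‖ ^ 2)
      + (1 + ‖x‖) ^ 2 * ‖φ₀ x‖ ^ (p + 1))

end ChernSimonsHiggs

/-!
The proof uses one vector field multiplier for each of the two null directions `∂_u`, where
`u = t - e x₁`, `v = t + e x₁`, `y = x₂` and `e = ±1`. The Chern–Simons equations give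
`F_{μν} J^ν = 0`, so the stress-energy tensor `T` of `φ` is divergence free, as for a scalar wave
equation. With `α = min ((p - 1) / 2) 2` take

  `X = f(u) ∂_u + y u h(u) ∂_y + y² h(u) ∂_v`,

where for `u ≥ 0` one has `h = (1 + u²)^{(α - 2) / 2}` and `f = (1 + u²)^{α / 2}`, and for `u ≤ 0`
one has `h = 1` and `f = 1 + κ u²` with `κ = max 1 ((p - 1) / 4)`. These functions are `C¹` across
`u = 0`. The field `X` is causal, because it is `h` times a null vector plus a nonnegative
multiple of `∂_u`. In `T` the derivative `D_u φ` is replaced by `D_u φ + σ φ` with `2 σ f = u h`. This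
plays the role of the lower order term `χ Re (conj φ * D_μ φ)`, `χ = u h / 2`, of the conformal
multiplier, and it keeps the dominant energy condition. The divergence of the modified current
(`stress_divergence`) consists of a quadratic form in `D_v φ`, `D_y φ` and a multiple of
`|φ|^{p+1}`, and both are nonnegative by the choice of the weights (`divergence_nonneg`): for `u ≥ 0`
the sign of the potential term is exactly the condition `α ≤ (p - 1) / 2`, and for `u ≤ 0` it is
`κ ≥ (p - 1) / 4`.

Hence the energy `∫ P_0 dx` of the current at time `t ≥ 0` is at most the initial one
(`energy_le`). No decay of the solution is needed: the current is multiplied by a cutoff with causal gradient, whose contribution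
has a sign by the dominant energy condition, and the cutoff is removed by Fatou's lemma. At time `t` the
energy density is at least a constant times `|φ|^{p+1} (1 + t + |x|)^α` on the half plane `e x₁ ≤ 0`
(`weighted_potential_le`), so the two signs `e = ±1` together cover the plane. At time `0` the
energy is at most a multiple of the conformal energy plus the mass `∫ |φ₀|²`, and the mass is
controlled by a weighted Hardy inequality in the plane (`hardy`). The decay at infinity that Hardy's inequality requires comes from
the weighted `L^{p+1}` bound on `φ₀`.
-/

namespace ChernSimonsHiggs

/-! ### The weight functions -/

theorem hasDerivAt_max_zero_sq (u : ℝ) :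
    HasDerivAt (fun u : ℝ => max u 0 ^ 2) (2 * max u 0) u := by
  rcases lt_trichotomy u 0 with h | rfl | h
  · rw [max_eq_right h.le, mul_zero]
    refine (hasDerivAt_const u (0 : ℝ)).congr_of_eventuallyEq ?_
    filter_upwards [gt_mem_nhds h] with v hv
    simp [max_eq_right hv.le]
  · rw [hasDerivAt_iff_isLittleO]
    have h2 : (fun x : ℝ => x ^ 2) =o[nhds 0] fun x => x := by
      simpa using Asymptotics.isLittleO_pow_id (𝕜 := ℝ) (n := 2) (by norm_num)
    refine Asymptotics.IsBigO.trans_isLittleO (g := fun x : ℝ => x ^ 2) ?_ (by simpa using h2)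
    refine Asymptotics.isBigO_of_le _ fun x => ?_
    rcases le_total x 0 with hx | hx <;> simp [hx, sq_nonneg]
  · rw [max_eq_left h.le]
    refine (by simpa using hasDerivAt_pow 2 u : HasDerivAt (fun u : ℝ => u ^ 2) (2 * u) u)
      |>.congr_of_eventuallyEq ?_
    filter_upwards [lt_mem_nhds h] with v hv
    simp [max_eq_left hv.le]

theorem hasDerivAt_min_zero_sq (u : ℝ) :
    HasDerivAt (fun u : ℝ => min u 0 ^ 2) (2 * min u 0) u := by
  have h := (hasDerivAt_max_zero_sq (-u)).comp u (hasDerivAt_neg u)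
  have e : ∀ u : ℝ, max (-u) 0 = -min u 0 := fun u => by
    have := max_neg_neg u 0
    simpa using this
  refine (h.congr_of_eventuallyEq (Filter.Eventually.of_forall fun v => ?_)).congr_deriv ?_
  · simp [e]
  · rw [e]; ring

/-- The weight `h(u) = (1 + u₊²)^{-β/2}`, the coefficient of `y² ∂_v` in the multiplier. -/
noncomputable def weightH (β u : ℝ) : ℝ := (1 + max u 0 ^ 2) ^ (-β / 2)

/-- The derivative of `weightH`, written out. -/
noncomputable def weightH' (β u : ℝ) : ℝ :=
  -β * max u 0 * (1 + max u 0 ^ 2) ^ (-β / 2 - 1)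

/-- The weight `f(u) = (1 + u²) h(u) + (κ - 1) u₋²`, the coefficient of `∂_u` in the multiplier. -/
noncomputable def weightF (β κ u : ℝ) : ℝ :=
  (1 + u ^ 2) * weightH β u + (κ - 1) * min u 0 ^ 2

/-- The derivative of `weightF`, written out. -/
noncomputable def weightF' (β κ u : ℝ) : ℝ :=
  2 * u * weightH β u + (1 + u ^ 2) * weightH' β u + 2 * (κ - 1) * min u 0

/-- The coefficient `σ = u h / (2 f)` of the modified derivative `D_u φ + σ φ`. -/
noncomputable def shift (β κ u : ℝ) : ℝ := u * weightH β u / (2 * weightF β κ u)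

theorem weightH_pos (β u : ℝ) : 0 < weightH β u := by
  unfold weightH; positivity

theorem weightH_le_one {β : ℝ} (hβ : 0 ≤ β) (u : ℝ) : weightH β u ≤ 1 := by
  unfold weightH
  exact Real.rpow_le_one_of_one_le_of_nonpos (by nlinarith [sq_nonneg (max u 0)]) (by linarith)

theorem weightH_of_nonpos (β : ℝ) {u : ℝ} (hu : u ≤ 0) : weightH β u = 1 := by
  simp [weightH, max_eq_right hu]

/-- The identity `(1 + u₊²) h' = -β u₊ h`, which replaces the explicit power in all sign
discussions. -/
theorem weightH'_eq (β u : ℝ) :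
    (1 + max u 0 ^ 2) * weightH' β u = -β * max u 0 * weightH β u := by
  unfold weightH' weightH
  have : (0 : ℝ) < 1 + max u 0 ^ 2 := by positivity
  rw [Real.rpow_sub_one this.ne']
  field_simp

theorem hasDerivAt_weightH (β u : ℝ) : HasDerivAt (weightH β) (weightH' β u) u := by
  have h := ((hasDerivAt_max_zero_sq u).const_add 1).rpow_const (p := -β / 2)
    (Or.inl (by positivity))
  refine h.congr_deriv ?_
  unfold weightH'; ring

theorem hasDerivAt_weightF (β κ u : ℝ) : HasDerivAt (weightF β κ) (weightF' β κ u) u := by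
  have h := ((((hasDerivAt_id u).pow 2).const_add 1).mul (hasDerivAt_weightH β u)).add
    ((hasDerivAt_min_zero_sq u).const_mul (κ - 1))
  refine h.congr_deriv ?_
  simp only [weightF', id, Nat.cast_ofNat, Nat.add_one_sub_one, pow_one, mul_one]
  simp only [Pi.pow_apply, id]
  ring

theorem weightF_ge {κ : ℝ} (hκ : 1 ≤ κ) (β u : ℝ) :
    (1 + u ^ 2) * weightH β u ≤ weightF β κ u := by
  unfold weightF
  nlinarith [mul_nonneg (sub_nonneg.2 hκ) (sq_nonneg (min u 0))]

theorem weightF_pos {κ : ℝ} (hκ : 1 ≤ κ) (β u : ℝ) : 0 < weightF β κ u :=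
  lt_of_lt_of_le (mul_pos (by positivity) (weightH_pos β u)) (weightF_ge hκ β u)

theorem weightF_le {β κ : ℝ} (hβ : 0 ≤ β) (hκ : 1 ≤ κ) (u : ℝ) :
    weightF β κ u ≤ κ * (1 + u ^ 2) := by
  have h1 := weightH_le_one hβ u
  have h2 : min u 0 ^ 2 ≤ u ^ 2 := by
    rcases le_total u 0 with h | h <;> simp [h]
  unfold weightF
  nlinarith [mul_le_mul_of_nonneg_left h2 (sub_nonneg.2 hκ),
    mul_nonneg (sq_nonneg u) (sub_nonneg.2 h1)]

theorem contDiff_weightH (β : ℝ) : ContDiff ℝ 1 (weightH β) := by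
  have h : deriv (weightH β) = weightH' β := funext fun u => (hasDerivAt_weightH β u).deriv
  refine contDiff_one_iff_deriv.2 ⟨fun u => (hasDerivAt_weightH β u).differentiableAt, ?_⟩
  rw [h]
  unfold weightH'
  refine Continuous.mul (by fun_prop) (Continuous.rpow_const (by fun_prop) fun u => Or.inl ?_)
  positivity

theorem contDiff_min_zero_sq : ContDiff ℝ 1 (fun u : ℝ => min u 0 ^ 2) := by
  have h : deriv (fun u : ℝ => min u 0 ^ 2) = fun u => 2 * min u 0 :=
    funext fun u => (hasDerivAt_min_zero_sq u).deriv
  refine contDiff_one_iff_deriv.2 ⟨fun u => (hasDerivAt_min_zero_sq u).differentiableAt, ?_⟩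
  rw [h]; fun_prop

theorem contDiff_max_zero_sq : ContDiff ℝ 1 (fun u : ℝ => max u 0 ^ 2) := by
  have h : deriv (fun u : ℝ => max u 0 ^ 2) = fun u => 2 * max u 0 :=
    funext fun u => (hasDerivAt_max_zero_sq u).deriv
  refine contDiff_one_iff_deriv.2 ⟨fun u => (hasDerivAt_max_zero_sq u).differentiableAt, ?_⟩
  rw [h]; fun_prop

theorem contDiff_weightF (β κ : ℝ) : ContDiff ℝ 1 (weightF β κ) := by
  have h1 := contDiff_weightH β
  have h2 := contDiff_min_zero_sq
  unfold weightF
  fun_prop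

theorem contDiff_shift (β : ℝ) {κ : ℝ} (hκ : 1 ≤ κ) : ContDiff ℝ 1 (shift β κ) := by
  have h1 := contDiff_weightH β
  have h2 := contDiff_weightF β κ
  unfold shift
  exact ContDiff.div (by fun_prop) (by fun_prop) fun u => by
    have := weightF_pos hκ β u; positivity

/-- The relation `g = 2 σ f` for `g = u h`, which removes all terms of order zero in `φ` from the
divergence of the current. -/
theorem shift_mul_weightF (β : ℝ) {κ : ℝ} (hκ : 1 ≤ κ) (u : ℝ) :
    u * weightH β u = 2 * shift β κ u * weightF β κ u := by
  have := (weightF_pos hκ β u).ne'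
  unfold shift; field_simp

/-! ### Gauge-covariant calculus -/

/-- The real inner product `Re (a * conj b)` of complex numbers. -/
def rdot (a b : ℂ) : ℝ := a.re * b.re + a.im * b.im

/-- The covariant derivative `D_w f = w^μ D_μ f` in the constant direction `w`. -/
noncomputable def covDir (A : Fin 3 → Spacetime → ℝ) (w : Spacetime) (f : Spacetime → ℂ)
    (z : Spacetime) : ℂ := ∑ μ, (w μ : ℂ) * covD A μ f z

theorem fderiv_eq_sum_pd {E : Type*} [NormedAddCommGroup E] [NormedSpace ℝ E]
    (f : Spacetime → E) (z w : Spacetime) : fderiv ℝ f z w = ∑ μ, w μ • pd μ f z := by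
  unfold pd
  conv_lhs => rw [← Finset.univ_sum_single w]
  rw [map_sum]
  refine Finset.sum_congr rfl fun i _ => ?_
  rw [← map_smul, ← Pi.single_smul]; simp

theorem covDir_eq (A : Fin 3 → Spacetime → ℝ) (w : Spacetime) (f : Spacetime → ℂ)
    (z : Spacetime) :
    covDir A w f z = fderiv ℝ f z w + Complex.I * ((∑ μ, w μ * A μ z : ℝ) : ℂ) * f z := by
  rw [fderiv_eq_sum_pd]
  simp only [covDir, covD, Fin.sum_univ_three, Complex.real_smul]
  push_cast; ring

/-- The covariant derivative is compatible with the inner product, so the connection drops out. -/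
theorem hasLineDerivAt_rdot (A : Fin 3 → Spacetime → ℝ) {a b : Spacetime → ℂ} {z : Spacetime}
    (ha : DifferentiableAt ℝ a z) (hb : DifferentiableAt ℝ b z) (w : Spacetime) :
    HasLineDerivAt ℝ (fun z => rdot (a z) (b z))
      (rdot (covDir A w a z) (b z) + rdot (a z) (covDir A w b z)) z w := by
  have h1 := (ha.hasFDerivAt.hasLineDerivAt w)
  have h2 := (hb.hasFDerivAt.hasLineDerivAt w)
  unfold HasLineDerivAt at *
  have r1 := (Complex.reCLM.hasFDerivAt.comp_hasDerivAt 0 h1)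
  have i1 := (Complex.imCLM.hasFDerivAt.comp_hasDerivAt 0 h1)
  have r2 := (Complex.reCLM.hasFDerivAt.comp_hasDerivAt 0 h2)
  have i2 := (Complex.imCLM.hasFDerivAt.comp_hasDerivAt 0 h2)
  refine ((r1.mul r2).add (i1.mul i2)).congr_deriv ?_
  simp only [Function.comp, zero_smul, add_zero, covDir_eq, rdot]
  simp only [Complex.reCLM_apply, Complex.imCLM_apply, Complex.add_re, Complex.add_im,
    Complex.mul_re, Complex.mul_im, Complex.I_re, Complex.I_im, Complex.ofReal_re,
    Complex.ofReal_im]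
  ring

theorem hasLineDerivAt_norm_rpow (A : Fin 3 → Spacetime → ℝ) {φ : Spacetime → ℂ} {z : Spacetime}
    (hφ : DifferentiableAt ℝ φ z) (w : Spacetime) {p : ℝ} (hp : 1 < p) :
    HasLineDerivAt ℝ (fun z => ‖φ z‖ ^ (p + 1))
      ((p + 1) * ‖φ z‖ ^ (p - 1) * rdot (φ z) (covDir A w φ z)) z w := by
  have h1 := (hφ.hasFDerivAt.hasLineDerivAt w)
  have h2 := (hasFDerivAt_norm_rpow (φ z) (p := p + 1) (by linarith))
  unfold HasLineDerivAt at *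
  have h3 := HasFDerivAt.comp_hasDerivAt (x := (0 : ℝ)) (f := fun t : ℝ => φ (z + t • w))
    (l := fun x : ℂ => ‖x‖ ^ (p + 1)) (by simpa using h2) h1
  refine h3.congr_deriv ?_
  simp only [covDir_eq, rdot]
  simp only [FunLike.coe_smul, Pi.smul_apply, innerSL_apply_apply, Complex.inner,
    Complex.add_re, Complex.add_im,
    Complex.mul_re, Complex.mul_im, Complex.I_re, Complex.I_im, Complex.ofReal_re,
    Complex.ofReal_im, Complex.conj_re, Complex.conj_im, smul_eq_mul]
  rw [show p + 1 - 2 = p - 1 by ring]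
  ring

theorem contDiff_covD {A : Fin 3 → Spacetime → ℝ} {φ : Spacetime → ℂ} (hφ : ContDiff ℝ 2 φ)
    (hA : ∀ μ, ContDiff ℝ 1 (A μ)) (μ : Fin 3) : ContDiff ℝ 1 (covD A μ φ) := by
  have h1 : ContDiff ℝ 1 (fderiv ℝ φ) := hφ.fderiv_right (by norm_num)
  have h2 : ContDiff ℝ 1 φ := hφ.of_le (by norm_num)
  have h3 : ContDiff ℝ 1 (fun z => (A μ z : ℂ)) := Complex.ofRealCLM.contDiff.comp (hA μ)
  unfold covD pd
  fun_prop

theorem contDiff_covDir {A : Fin 3 → Spacetime → ℝ} {φ : Spacetime → ℂ} (hφ : ContDiff ℝ 2 φ)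
    (hA : ∀ μ, ContDiff ℝ 1 (A μ)) (w : Spacetime) : ContDiff ℝ 1 (covDir A w φ) := by
  have := contDiff_covD hφ hA
  unfold covDir
  fun_prop

/-- Covariant derivatives commute up to the curvature. -/
theorem covD_comm {A : Fin 3 → Spacetime → ℝ} {φ : Spacetime → ℂ} (hφ : ContDiff ℝ 2 φ)
    (hA : ∀ μ, ContDiff ℝ 1 (A μ)) (μ ν : Fin 3) (z : Spacetime) :
    covD A μ (covD A ν φ) z =
      covD A ν (covD A μ φ) z + Complex.I * (curvature A μ ν z : ℂ) * φ z := by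
  have h1 : ContDiff ℝ 1 (fderiv ℝ φ) := hφ.fderiv_right (by norm_num)
  have d1 : DifferentiableAt ℝ (fderiv ℝ φ) z := h1.differentiable one_ne_zero z
  have d2 : DifferentiableAt ℝ φ z := hφ.differentiable two_ne_zero z
  have d3 : ∀ μ, HasFDerivAt (fun z => (A μ z : ℂ))
      (Complex.ofRealCLM.comp (fderiv ℝ (A μ) z)) z := fun μ =>
    Complex.ofRealCLM.hasFDerivAt.comp z ((hA μ).differentiable one_ne_zero z).hasFDerivAt
  have key : ∀ μ ν, pd μ (covD A ν φ) z =
      fderiv ℝ (fderiv ℝ φ) z (Pi.single μ 1) (Pi.single ν 1) +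
      (Complex.I * ((pd μ (A ν) z : ℝ) : ℂ) * φ z + Complex.I * (A ν z : ℂ) * pd μ φ z) := by
    intro μ ν
    have h : HasFDerivAt (covD A ν φ) _ z :=
      (d1.hasFDerivAt.clm_apply (hasFDerivAt_const (Pi.single ν (1 : ℝ) : Spacetime) z)).add
        (((d3 ν).const_mul Complex.I).mul d2.hasFDerivAt)
    unfold pd
    rw [h.fderiv]
    simp
    ring
  have sym : fderiv ℝ (fderiv ℝ φ) z (Pi.single μ 1) (Pi.single ν 1) =
      fderiv ℝ (fderiv ℝ φ) z (Pi.single ν 1) (Pi.single μ 1) :=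
    (hφ.contDiffAt.isSymmSndFDerivAt (by simp)) _ _
  unfold covD curvature
  have k1 := key μ ν
  have k2 := key ν μ
  unfold covD at k1 k2
  rw [k1, k2, sym]
  push_cast
  ring

/-- Iterated covariant derivatives in constant directions. -/
theorem covDir_covDir {A : Fin 3 → Spacetime → ℝ} {φ : Spacetime → ℂ} (hφ : ContDiff ℝ 2 φ)
    (hA : ∀ μ, ContDiff ℝ 1 (A μ)) (w w' z : Spacetime) :
    covDir A w (covDir A w' φ) z =
      ∑ μ, ∑ ν, (w μ : ℂ) * (w' ν : ℂ) * covD A μ (covD A ν φ) z := by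
  have d : ∀ ν, HasFDerivAt (covD A ν φ) (fderiv ℝ (covD A ν φ) z) z := fun ν =>
    ((contDiff_covD hφ hA ν).differentiable one_ne_zero z).hasFDerivAt
  have key : ∀ μ, covD A μ (covDir A w' φ) z = ∑ ν, (w' ν : ℂ) * covD A μ (covD A ν φ) z := by
    intro μ
    have h : HasFDerivAt (covDir A w' φ) _ z :=
      HasFDerivAt.fun_sum (u := Finset.univ) fun ν _ => (d ν).const_mul (w' ν : ℂ)
    rw [covD, pd, h.fderiv, covDir]
    simp only [covD, pd, Fin.sum_univ_three]
    simp
    ring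
  simp only [covDir] at key ⊢
  simp only [key, Finset.mul_sum, mul_assoc]

theorem covDir_add_smul {A : Fin 3 → Spacetime → ℝ} {α φ : Spacetime → ℂ} {s : Spacetime → ℝ}
    {s' : ℝ} {z w : Spacetime} (hα : DifferentiableAt ℝ α z) (hs : DifferentiableAt ℝ s z)
    (hφ : DifferentiableAt ℝ φ z) (hs' : HasLineDerivAt ℝ s s' z w) :
    covDir A w (fun z => α z + (s z : ℂ) * φ z) z =
      covDir A w α z + (s' : ℂ) * φ z + (s z : ℂ) * covDir A w φ z := by
  have d3 : HasFDerivAt (fun z => (s z : ℂ))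
      (Complex.ofRealCLM.comp (fderiv ℝ s z)) z :=
    Complex.ofRealCLM.hasFDerivAt.comp z hs.hasFDerivAt
  have h := (hα.hasFDerivAt.fun_add (d3.fun_mul hφ.hasFDerivAt))
  have e : fderiv ℝ s z w = s' := by
    have := hs.hasFDerivAt.hasLineDerivAt w
    exact HasDerivAt.unique this hs'
  rw [covDir_eq, covDir_eq, covDir_eq, h.fderiv]
  simp [e]
  ring

/-! ### The null frame -/

/-- The null vector `∂_u = (∂_t - e ∂_1) / 2`, where `u = t - e x₁`, `v = t + e x₁`, `e = ±1`. -/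
noncomputable def frameU (e : ℝ) : Spacetime := ![1 / 2, -e / 2, 0]

/-- The null vector `∂_v = (∂_t + e ∂_1) / 2`. -/
noncomputable def frameV (e : ℝ) : Spacetime := ![1 / 2, e / 2, 0]

/-- The spacelike vector `∂_y = ∂_2`. -/
def frameY : Spacetime := ![0, 0, 1]

theorem covDir_frameU (A : Fin 3 → Spacetime → ℝ) (e : ℝ) (f : Spacetime → ℂ) (z : Spacetime) :
    covDir A (frameU e) f z =
      ((1 / 2 : ℝ) : ℂ) * covD A 0 f z - ((e / 2 : ℝ) : ℂ) * covD A 1 f z := by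
  simp [covDir, Fin.sum_univ_three, frameU]
  ring

theorem covDir_frameV (A : Fin 3 → Spacetime → ℝ) (e : ℝ) (f : Spacetime → ℂ) (z : Spacetime) :
    covDir A (frameV e) f z =
      ((1 / 2 : ℝ) : ℂ) * covD A 0 f z + ((e / 2 : ℝ) : ℂ) * covD A 1 f z := by
  simp [covDir, Fin.sum_univ_three, frameV]

theorem covDir_frameY (A : Fin 3 → Spacetime → ℝ) (f : Spacetime → ℂ) (z : Spacetime) :
    covDir A frameY f z = covD A 2 f z := by
  simp [covDir, Fin.sum_univ_three, frameY]

theorem mink_eq_ite (μ ν : Fin 3) : mink μ ν = if μ = ν then (if μ = 0 then -1 else 1) else 0 := by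
  fin_cases μ <;> fin_cases ν <;> simp [mink]

/-- The Chern–Simons equations `F_{01} = J_2`, `F_{02} = -J_1`, `F_{12} = -J_0`. -/
theorem curvature_components {p : ℝ} {φ₀ φ₁ : Space → ℂ} {φ : Spacetime → ℂ}
    {A : Fin 3 → Spacetime → ℝ} (hs : IsSolution p φ₀ φ₁ φ A) {z : Spacetime} (hz : 0 ≤ z 0) :
    curvature A 0 1 z = current A φ 2 z ∧ curvature A 0 2 z = -current A φ 1 z ∧
      curvature A 1 2 z = -current A φ 0 z := by
  have h := hs.curvature_eq z hz
  refine ⟨?_, ?_, ?_⟩ <;> rw [h] <;>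
    simp [Fin.sum_univ_three, eps, currentUp, mink_eq_ite] <;> norm_num

/-- The wave equation in the null frame. -/
theorem frame_wave {p : ℝ} {φ₀ φ₁ : Space → ℂ} {φ : Spacetime → ℂ}
    {A : Fin 3 → Spacetime → ℝ} (hs : IsSolution p φ₀ φ₁ φ A) {e : ℝ} (he : e ^ 2 = 1)
    {z : Spacetime} (hz : 0 ≤ z 0) :
    covDir A frameY (covDir A frameY φ) z = ((‖φ z‖ ^ (p - 1) : ℝ) : ℂ) * φ z +
      2 * covDir A (frameU e) (covDir A (frameV e) φ) z +
      2 * covDir A (frameV e) (covDir A (frameU e) φ) z := by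
  rw [← hs.wave_eq z hz]
  have he' : (e : ℂ) ^ 2 = 1 := by exact_mod_cast he
  simp only [covDir_covDir hs.contDiff_field hs.contDiff_connection, boxA, Fin.sum_univ_three,
    frameU, frameV, frameY, mink_eq_ite]
  simp
  linear_combination (covD A 1 (covD A 1 φ) z) * he'

/-- The commutator `[D_u, D_v] φ = i F_{uv} φ` with `F_{uv}` given by the Chern–Simons equation. -/
theorem frame_comm_UV {p : ℝ} {φ₀ φ₁ : Space → ℂ} {φ : Spacetime → ℂ}
    {A : Fin 3 → Spacetime → ℝ} (hs : IsSolution p φ₀ φ₁ φ A) (e : ℝ)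
    {z : Spacetime} (hz : 0 ≤ z 0) :
    covDir A (frameU e) (covDir A (frameV e) φ) z =
      covDir A (frameV e) (covDir A (frameU e) φ) z +
      Complex.I * ((e / 2 * (φ z * (starRingEnd ℂ) (covDir A frameY φ z)).im : ℝ) : ℂ) * φ z := by
  obtain ⟨h1, -, -⟩ := curvature_components hs hz
  have c := covD_comm hs.contDiff_field hs.contDiff_connection 0 1 z
  rw [h1] at c
  rw [current, ← covDir_frameY] at c
  simp only [covDir_covDir hs.contDiff_field hs.contDiff_connection, Fin.sum_univ_three,
    frameU, frameV]
  simp at c ⊢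
  linear_combination (e / 2 : ℂ) * c

/-- The commutator `[D_u, D_y] φ = i F_{uy} φ`. -/
theorem frame_comm_UY {p : ℝ} {φ₀ φ₁ : Space → ℂ} {φ : Spacetime → ℂ}
    {A : Fin 3 → Spacetime → ℝ} (hs : IsSolution p φ₀ φ₁ φ A) {e : ℝ} (he : e ^ 2 = 1)
    {z : Spacetime} (hz : 0 ≤ z 0) :
    covDir A (frameU e) (covDir A frameY φ) z =
      covDir A frameY (covDir A (frameU e) φ) z + Complex.I *
        ((e * (φ z * (starRingEnd ℂ) (covDir A (frameU e) φ z)).im : ℝ) : ℂ) * φ z := by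
  obtain ⟨-, h1, h2⟩ := curvature_components hs hz
  have c := covD_comm hs.contDiff_field hs.contDiff_connection 0 2 z
  have c' := covD_comm hs.contDiff_field hs.contDiff_connection 1 2 z
  rw [h1] at c
  rw [h2] at c'
  have he' : (e : ℂ) ^ 2 = 1 := by exact_mod_cast he
  have key : e * (φ z * (starRingEnd ℂ) (covDir A (frameU e) φ z)).im =
      e / 2 * current A φ 0 z - 1 / 2 * current A φ 1 z := by
    simp only [current, covDir_frameU, map_sub, map_mul, Complex.conj_ofReal,
      Complex.mul_im, Complex.mul_re, Complex.sub_re, Complex.sub_im,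
      Complex.ofReal_re, Complex.ofReal_im, Complex.conj_re, Complex.conj_im]
    linear_combination (-1 / 2 * ((φ z).im * (covD A 1 φ z).re
      - (φ z).re * (covD A 1 φ z).im)) * he
  rw [key]
  simp only [covDir_covDir hs.contDiff_field hs.contDiff_connection, Fin.sum_univ_three,
    frameU, frameY]
  simp at c c' ⊢
  linear_combination (1 / 2 : ℂ) * c - (e / 2 : ℂ) * c'

/-- The commutator `[D_v, D_y] φ = i F_{vy} φ`. -/
theorem frame_comm_VY {p : ℝ} {φ₀ φ₁ : Space → ℂ} {φ : Spacetime → ℂ}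
    {A : Fin 3 → Spacetime → ℝ} (hs : IsSolution p φ₀ φ₁ φ A) {e : ℝ} (he : e ^ 2 = 1)
    {z : Spacetime} (hz : 0 ≤ z 0) :
    covDir A (frameV e) (covDir A frameY φ) z =
      covDir A frameY (covDir A (frameV e) φ) z - Complex.I *
        ((e * (φ z * (starRingEnd ℂ) (covDir A (frameV e) φ z)).im : ℝ) : ℂ) * φ z := by
  obtain ⟨-, h1, h2⟩ := curvature_components hs hz
  have c := covD_comm hs.contDiff_field hs.contDiff_connection 0 2 z
  have c' := covD_comm hs.contDiff_field hs.contDiff_connection 1 2 z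
  rw [h1] at c
  rw [h2] at c'
  have key : e * (φ z * (starRingEnd ℂ) (covDir A (frameV e) φ z)).im =
      e / 2 * current A φ 0 z + 1 / 2 * current A φ 1 z := by
    simp only [current, covDir_frameV, map_add, map_mul, Complex.conj_ofReal,
      Complex.mul_im, Complex.mul_re, Complex.add_re, Complex.add_im,
      Complex.ofReal_re, Complex.ofReal_im, Complex.conj_re, Complex.conj_im]
    linear_combination (1 / 2 * ((φ z).im * (covD A 1 φ z).re
      - (φ z).re * (covD A 1 φ z).im)) * he
  rw [key]
  simp only [covDir_covDir hs.contDiff_field hs.contDiff_connection, Fin.sum_univ_three,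
    frameV, frameY]
  simp at c c' ⊢
  linear_combination (1 / 2 : ℂ) * c + (e / 2 : ℂ) * c'

/-! ### Algebra of the energy current -/

/-- The `∂_u` component of the current `T_{μν} X^ν` for the multiplier
`X = f ∂_u + G ∂_y + H ∂_v`, where `T` is the stress-energy tensor built from the derivatives `a`,
`b`, `c` along `∂_u`, `∂_v`, `∂_y` and from the potential `V = |φ|^{p+1} / (2 (p+1))`. -/
noncomputable def stressU (f G H V : ℝ) (a c : ℂ) : ℝ :=
  f * rdot a a + G * rdot a c + H * (rdot c c / 4 + V)

/-- The `∂_v` component of the current `T_{μν} X^ν`. -/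
noncomputable def stressV (f G H V : ℝ) (b c : ℂ) : ℝ :=
  f * (rdot c c / 4 + V) + G * rdot c b + H * rdot b b

/-- The `∂_y` component of the current `T_{μν} X^ν`. -/
noncomputable def stressY (f G H V : ℝ) (a b c : ℂ) : ℝ :=
  f * rdot c a + G * (rdot c c / 2 + 2 * rdot a b - 2 * V) + H * rdot c b

theorem rdot_self_nonneg (a : ℂ) : 0 ≤ rdot a a := by
  unfold rdot; nlinarith [mul_self_nonneg a.re, mul_self_nonneg a.im]

/-- A binary quadratic form with nonnegative diagonal and nonnegative discriminant is positive. -/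
theorem quadratic_nonneg {l m n : ℝ} (hl : 0 ≤ l) (hm : 0 ≤ m) (hn : n ^ 2 ≤ l * m) (x y : ℝ) :
    0 ≤ l * x ^ 2 + m * y ^ 2 - 2 * n * (x * y) := by
  rcases hl.eq_or_lt with rfl | hl
  · have : n = 0 := by nlinarith
    subst this; nlinarith [mul_nonneg hm (sq_nonneg y)]
  · have h : 0 ≤ l * (l * x ^ 2 + m * y ^ 2 - 2 * n * (x * y)) := by
      nlinarith [sq_nonneg (l * x - n * y), mul_nonneg (sub_nonneg.2 hn) (sq_nonneg y)]
    exact nonneg_of_mul_nonneg_right h hl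

/-- The dominant energy condition: the current of the causal multiplier
`h (u² ∂_u + u y ∂_y + y² ∂_v) + δ ∂_u` is nonnegative on causal covectors. -/
theorem stress_dominant {u y h δ V l m n : ℝ} (hh : 0 ≤ h) (hδ : 0 ≤ δ) (hV : 0 ≤ V)
    (hl : 0 ≤ l) (hm : 0 ≤ m) (hn : n ^ 2 ≤ l * m) (a b c : ℂ) :
    0 ≤ l * stressU (u ^ 2 * h + δ) (y * u * h) (y ^ 2 * h) V a c
      + m * stressV (u ^ 2 * h + δ) (y * u * h) (y ^ 2 * h) V b c
      - n * stressY (u ^ 2 * h + δ) (y * u * h) (y ^ 2 * h) V a b c := by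
  have q := fun x y => quadratic_nonneg hl hm hn x y
  -- The two null vectors making up the multiplier are treated separately, and each splits into the
  -- real parts, the imaginary parts and the potential.
  have h1 := mul_nonneg hh (q (u * a.re + y / 2 * c.re) (u / 2 * c.re + y * b.re))
  have h2 := mul_nonneg hh (q (u * a.im + y / 2 * c.im) (u / 2 * c.im + y * b.im))
  have h3 := mul_nonneg hh (mul_nonneg hV (q y (-u)))
  have h4 := mul_nonneg hδ (q a.re (c.re / 2))
  have h5 := mul_nonneg hδ (q a.im (c.im / 2))
  have h6 := mul_nonneg hδ (mul_nonneg hm hV)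
  unfold stressU stressV stressY rdot
  linarith

/-- The energy density on `t = const` dominates the potential, the derivative terms being sums of
squares. -/
theorem stress_lower_bound {u y h δ V : ℝ} (hh : 0 ≤ h) (hδ : 0 ≤ δ) (a b c : ℂ) :
    V * (h * (u ^ 2 + y ^ 2) + δ) ≤ stressU (u ^ 2 * h + δ) (y * u * h) (y ^ 2 * h) V a c
      + stressV (u ^ 2 * h + δ) (y * u * h) (y ^ 2 * h) V b c := by
  have h0 := fun a : ℝ => sq_nonneg a
  have h1 := mul_nonneg hh (h0 (u * a.re + y / 2 * c.re))
  have h2 := mul_nonneg hh (h0 (u * a.im + y / 2 * c.im))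
  have h3 := mul_nonneg hh (h0 (u / 2 * c.re + y * b.re))
  have h4 := mul_nonneg hh (h0 (u / 2 * c.im + y * b.im))
  have h5 := mul_nonneg hδ (rdot_self_nonneg a)
  have h6 := mul_nonneg hδ (rdot_self_nonneg c)
  unfold stressU stressV
  unfold rdot at *
  linarith

/-- The divergence of the current. The letters `Ub`, `Uc`, … stand for the covariant derivatives of
`b`, `c`, … in the directions `∂_u`, `∂_v`, `∂_y`, and `a₀` is the unmodified derivative `D_u φ`.
The curvature terms cancel because `F_{μν} J^ν = 0`, and `g = 2 σ f` makes the terms of order zero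
cancel. -/
theorem stress_divergence (e N V y f f' h h' g g' σ : ℝ) (φ a₀ b c Ub Uc Va Vc Ya Yb Yc : ℂ)
    (hg : g = 2 * σ * f)
    (hw : Yc = (N : ℂ) * φ + 2 * Ub + 2 * Va)
    (hUV : Ub = Va + Complex.I * ((e / 2 * (φ * (starRingEnd ℂ) c).im : ℝ) : ℂ) * φ)
    (hUY : Uc = Ya + Complex.I * ((e * (φ * (starRingEnd ℂ) a₀).im : ℝ) : ℂ) * φ)
    (hVY : Vc = Yb - Complex.I * ((e * (φ * (starRingEnd ℂ) b).im : ℝ) : ℂ) * φ) :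
    -2 * (f' * (rdot c c / 4 + V) + f * ((rdot Uc c + rdot c Uc) / 4 + N / 2 * rdot φ a₀)
        + (y * g' * rdot c b + y * g * (rdot Uc b + rdot c Ub))
        + (y ^ 2 * h' * rdot b b + y ^ 2 * h * (rdot Ub b + rdot b Ub)))
      - 2 * (f * (rdot (Va + σ * b) (a₀ + σ * φ) + rdot (a₀ + σ * φ) (Va + σ * b))
        + y * g * (rdot (Va + σ * b) c + rdot (a₀ + σ * φ) Vc)
        + y ^ 2 * h * ((rdot Vc c + rdot c Vc) / 4 + N / 2 * rdot φ b))
      + (f * (rdot Yc (a₀ + σ * φ) + rdot c (Ya + σ * c))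
        + (g * (rdot c c / 2 + 2 * rdot (a₀ + σ * φ) b - 2 * V)
          + y * g * ((rdot Yc c + rdot c Yc) / 2
            + 2 * (rdot (Ya + σ * c) b + rdot (a₀ + σ * φ) Yb) - 2 * (N / 2 * rdot φ c)))
        + (2 * y * h * rdot c b + y ^ 2 * h * (rdot Yc b + rdot c Yb)))
      = -2 * V * (f' + g) + σ * f * N * rdot φ φ
        + (g - f' / 2) * rdot c c - 2 * y * (g' - h) * rdot c b - 2 * y ^ 2 * h' * rdot b b := by
  subst hg hw hUY hVY hUV
  simp only [rdot, Complex.add_re, Complex.add_im, Complex.sub_re, Complex.sub_im,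
    Complex.mul_re, Complex.mul_im, Complex.I_re, Complex.I_im, Complex.ofReal_re,
    Complex.ofReal_im, Complex.conj_re, Complex.conj_im, Complex.re_ofNat, Complex.im_ofNat]
  ring

/-- The divergence computed in `stress_divergence` is nonnegative for the chosen weights. Here
`W = |φ|^{p+1} = 2 (p+1) V`. -/
theorem divergence_nonneg {p β κ : ℝ} (hp : 1 < p) (hβ : 0 ≤ β) (hβ' : 2 - β ≤ (p - 1) / 2)
    (hκ : 1 ≤ κ) (hκ' : (p - 1) / 4 ≤ κ) (u y : ℝ) {W : ℝ} (hW : 0 ≤ W) (b c : ℂ) :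
    0 ≤ -2 * (W / (2 * (p + 1))) * (weightF' β κ u + u * weightH β u)
        + u * weightH β u / 2 * W
        + (u * weightH β u - weightF' β κ u / 2) * rdot c c
        - 2 * y * (weightH β u + u * weightH' β u - weightH β u) * rdot c b
        - 2 * y ^ 2 * weightH' β u * rdot b b := by
  have hp1 : 0 < p + 1 := by linarith
  have hc := rdot_self_nonneg c
  have hb := rdot_self_nonneg b
  have e1 : -2 * (W / (2 * (p + 1))) * (weightF' β κ u + u * weightH β u)
      + u * weightH β u / 2 * W =
      W / (p + 1) * ((p - 1) / 2 * (u * weightH β u) - weightF' β κ u) := by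
    field_simp; ring
  rw [e1]
  rcases le_total u 0 with hu | hu
  · have h1 : weightH' β u = 0 := by simp [weightH', max_eq_right hu]
    have h2 : weightF' β κ u = 2 * κ * u := by
      simp only [weightF', weightH_of_nonpos β hu, h1, min_eq_left hu]; ring
    rw [h2, h1, weightH_of_nonpos β hu]
    have h3 : 0 ≤ W / (p + 1) * ((2 * κ - (p - 1) / 2) * (-u)) :=
      mul_nonneg (by positivity) (mul_nonneg (by linarith) (by linarith))
    have h4 : 0 ≤ (κ - 1) * (-u) * rdot c c :=
      mul_nonneg (mul_nonneg (by linarith) (by linarith)) hc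
    linarith
  · have hh := weightH_pos β u
    have hH := weightH'_eq β u
    rw [max_eq_left hu] at hH
    have h2 : weightF' β κ u = (2 - β) * (u * weightH β u) := by
      simp only [weightF', min_eq_right hu]; linarith
    have hr : 0 < 1 + u ^ 2 := by positivity
    -- The quadratic form in `(b, c)` is `β u h` times this sum of squares.
    have h1 : weightH' β u = -β * u * weightH β u / (1 + u ^ 2) := by
      field_simp; linarith
    set r := u / (1 + u ^ 2) with hrdef
    have h5 : 0 ≤ rdot (c + (2 * y * r : ℝ) * b) (c + (2 * y * r : ℝ) * b) :=
      rdot_self_nonneg _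
    have h6 : u * r + 1 / (1 + u ^ 2) = 1 := by rw [hrdef]; field_simp; ring
    have h8 : r = u * (1 / (1 + u ^ 2)) := by rw [hrdef]; ring
    set k := 1 / (1 + u ^ 2) with hk
    have h9 : weightH' β u = -β * u * weightH β u * k := by rw [h1, hk]; ring
    have h7 : 0 ≤ W / (p + 1) * (((p - 1) / 2 - (2 - β)) * (u * weightH β u)) :=
      mul_nonneg (by positivity) (mul_nonneg (by linarith) (by positivity))
    have h10 : 0 ≤ β * (u * weightH β u) := by positivity
    have h11 : 0 ≤ y ^ 2 * k ^ 2 * rdot b b := by positivity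
    have h12 : rdot (c + (2 * y * r : ℝ) * b) (c + (2 * y * r : ℝ) * b) =
        rdot c c + 4 * y * r * rdot c b + 4 * y ^ 2 * r ^ 2 * rdot b b := by
      simp only [rdot, Complex.add_re, Complex.add_im, Complex.mul_re, Complex.mul_im,
        Complex.ofReal_re, Complex.ofReal_im]
      ring
    rw [h12] at h5
    have h13 := mul_nonneg h10 (add_nonneg h5 (mul_nonneg (by norm_num : (0 : ℝ) ≤ 4) h11))
    have h14 : r ^ 2 + k ^ 2 = k := by rw [h8] at h6 ⊢; linear_combination k * h6
    rw [h2, h9]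
    have h15 : u * k = r := h8.symm
    have h16 : 0 ≤ β * (u * weightH β u) *
        (rdot c c + 4 * y * r * rdot c b + 4 * y ^ 2 * k * rdot b b) := by
      rw [← h14]; linarith
    rw [← h15] at h16
    linarith

/-! ### The energy current -/

section EnergyCurrent

variable (p β κ e : ℝ) (φ : Spacetime → ℂ) (A : Fin 3 → Spacetime → ℝ)

/-- The optical function `u = t - e x₁`. -/
def optical (z : Spacetime) : ℝ := z 0 - e * z 1

/-- The modified derivative `D_u φ + σ(u) φ`. -/
noncomputable def modDerivU (z : Spacetime) : ℂ :=
  covDir A (frameU e) φ z + (shift β κ (optical e z) : ℂ) * φ z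

/-- The potential `|φ|^{p+1} / (2 (p+1))`. -/
noncomputable def potential (z : Spacetime) : ℝ := ‖φ z‖ ^ (p + 1) / (2 * (p + 1))

/-- The `∂_u` component of the modified energy current of `f ∂_u + y u h ∂_y + y² h ∂_v`. -/
noncomputable def currentU (z : Spacetime) : ℝ :=
  stressU (weightF β κ (optical e z)) (z 2 * optical e z * weightH β (optical e z))
    (z 2 ^ 2 * weightH β (optical e z)) (potential p φ z) (modDerivU β κ e φ A z)
    (covDir A frameY φ z)

/-- The `∂_v` component of the modified energy current. -/
noncomputable def currentV (z : Spacetime) : ℝ :=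
  stressV (weightF β κ (optical e z)) (z 2 * optical e z * weightH β (optical e z))
    (z 2 ^ 2 * weightH β (optical e z)) (potential p φ z) (covDir A (frameV e) φ z)
    (covDir A frameY φ z)

/-- The `∂_y` component of the modified energy current. -/
noncomputable def currentY (z : Spacetime) : ℝ :=
  stressY (weightF β κ (optical e z)) (z 2 * optical e z * weightH β (optical e z))
    (z 2 ^ 2 * weightH β (optical e z)) (potential p φ z) (modDerivU β κ e φ A z)
    (covDir A (frameV e) φ z) (covDir A frameY φ z)

end EnergyCurrent

variable {p β κ e : ℝ} {φ₀ φ₁ : Space → ℂ} {φ : Spacetime → ℂ} {A : Fin 3 → Spacetime → ℝ}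

theorem hasLineDerivAt_comp_optical {F : ℝ → ℝ} {F' : ℝ} {z : Spacetime}
    (hF : HasDerivAt F F' (optical e z)) (w : Spacetime) :
    HasLineDerivAt ℝ (fun z => F (optical e z)) (F' * (w 0 - e * w 1)) z w := by
  have h : HasDerivAt (fun t : ℝ => optical e (z + t • w)) (w 0 - e * w 1) 0 := by
    have h0 := ((hasDerivAt_id (0 : ℝ)).mul_const (w 0)).const_add (z 0)
    have h1 := ((hasDerivAt_id (0 : ℝ)).mul_const (w 1)).const_add (z 1)
    refine (h0.sub (h1.const_mul e)).congr_deriv (by simp)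
  exact HasDerivAt.comp (x := (0 : ℝ)) (h₂ := F) (h := fun t : ℝ => optical e (z + t • w))
    (by simpa using hF) h

theorem hasLineDerivAt_apply (i : Fin 3) (z w : Spacetime) :
    HasLineDerivAt ℝ (fun z : Spacetime => z i) (w i) z w := by
  refine (((hasDerivAt_id (0 : ℝ)).mul_const (w i)).const_add (z i)).congr_deriv (by simp)

theorem contDiff_optical : ContDiff ℝ 1 (optical e) := by
  unfold optical; fun_prop

theorem contDiff_modDerivU (hs : IsSolution p φ₀ φ₁ φ A) (hκ : 1 ≤ κ) :
    ContDiff ℝ 1 (modDerivU β κ e φ A) := by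
  have h1 := contDiff_covDir hs.contDiff_field hs.contDiff_connection (frameU e)
  have h2 : ContDiff ℝ 1 φ := hs.contDiff_field.of_le (by norm_num)
  have h3 : ContDiff ℝ 1 (fun z => (shift β κ (optical e z) : ℂ)) :=
    Complex.ofRealCLM.contDiff.comp ((contDiff_shift β hκ).comp contDiff_optical)
  unfold modDerivU
  fun_prop

theorem contDiff_rdot {a b : Spacetime → ℂ} (ha : ContDiff ℝ 1 a) (hb : ContDiff ℝ 1 b) :
    ContDiff ℝ 1 (fun z => rdot (a z) (b z)) := by
  have h1 : ContDiff ℝ 1 (fun z => (a z).re) := Complex.reCLM.contDiff.comp ha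
  have h2 : ContDiff ℝ 1 (fun z => (a z).im) := Complex.imCLM.contDiff.comp ha
  have h3 : ContDiff ℝ 1 (fun z => (b z).re) := Complex.reCLM.contDiff.comp hb
  have h4 : ContDiff ℝ 1 (fun z => (b z).im) := Complex.imCLM.contDiff.comp hb
  unfold rdot
  fun_prop

theorem contDiff_currents (hp : 1 < p) (hs : IsSolution p φ₀ φ₁ φ A) (hκ : 1 ≤ κ) :
    ContDiff ℝ 1 (currentU p β κ e φ A) ∧ ContDiff ℝ 1 (currentV p β κ e φ A) ∧
      ContDiff ℝ 1 (currentY p β κ e φ A) := by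
  have h2 : ContDiff ℝ 1 φ := hs.contDiff_field.of_le (by norm_num)
  have hu : ContDiff ℝ 1 (optical e) := contDiff_optical
  have hf := (contDiff_weightF β κ).comp hu
  have hh := (contDiff_weightH β).comp hu
  have ha : ContDiff ℝ 1 (modDerivU β κ e φ A) := contDiff_modDerivU hs hκ
  have hb := contDiff_covDir hs.contDiff_field hs.contDiff_connection (frameV e)
  have hc := contDiff_covDir hs.contDiff_field hs.contDiff_connection frameY
  have hV : ContDiff ℝ 1 (potential p φ) := by
    unfold potential
    exact (h2.norm_rpow (by linarith)).div_const _
  have haa := contDiff_rdot ha ha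
  have hac := contDiff_rdot ha hc
  have hca := contDiff_rdot hc ha
  have hcc := contDiff_rdot hc hc
  have hcb := contDiff_rdot hc hb
  have hab := contDiff_rdot ha hb
  have hbb := contDiff_rdot hb hb
  have hy : ContDiff ℝ 1 (fun z : Spacetime => z 2) := by fun_prop
  simp only [Function.comp_def] at hf hh
  refine ⟨?_, ?_, ?_⟩
  · unfold currentU stressU; fun_prop
  · unfold currentV stressV; fun_prop
  · unfold currentY stressY; fun_prop

/-- The current has nonnegative divergence in the null frame. -/
theorem null_divergence_nonneg (hp : 1 < p) (hβ : 0 ≤ β) (hβ' : 2 - β ≤ (p - 1) / 2)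
    (hκ : 1 ≤ κ) (hκ' : (p - 1) / 4 ≤ κ) (he : e ^ 2 = 1) (hs : IsSolution p φ₀ φ₁ φ A)
    {z : Spacetime} (hz : 0 ≤ z 0) :
    0 ≤ -2 * fderiv ℝ (currentV p β κ e φ A) z (frameU e)
      - 2 * fderiv ℝ (currentU p β κ e φ A) z (frameV e)
      + fderiv ℝ (currentY p β κ e φ A) z frameY := by
  obtain ⟨cU, cV, cY⟩ := contDiff_currents (β := β) (e := e) hp hs hκ
  have c2 : ContDiff ℝ 1 φ := hs.contDiff_field.of_le (by norm_num)
  have dφ : DifferentiableAt ℝ φ z := c2.differentiable one_ne_zero z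
  have da₀ : DifferentiableAt ℝ (covDir A (frameU e) φ) z :=
    (contDiff_covDir hs.contDiff_field hs.contDiff_connection _).differentiable one_ne_zero z
  have db : DifferentiableAt ℝ (covDir A (frameV e) φ) z :=
    (contDiff_covDir hs.contDiff_field hs.contDiff_connection _).differentiable one_ne_zero z
  have dc : DifferentiableAt ℝ (covDir A frameY φ) z :=
    (contDiff_covDir hs.contDiff_field hs.contDiff_connection _).differentiable one_ne_zero z
  have ds : DifferentiableAt ℝ (fun z => shift β κ (optical e z)) z :=
    ((contDiff_shift β hκ).comp (contDiff_optical (e := e))).differentiable one_ne_zero z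
  have da : DifferentiableAt ℝ (modDerivU β κ e φ A) z :=
    (contDiff_modDerivU hs hκ).differentiable one_ne_zero z
  have dV : ∀ w, HasLineDerivAt ℝ (potential p φ)
      (‖φ z‖ ^ (p - 1) / 2 * rdot (φ z) (covDir A w φ z)) z w := fun w => by
    have := hasLineDerivAt_norm_rpow A dφ w hp
    unfold HasLineDerivAt at *
    refine (this.div_const (2 * (p + 1))).congr_deriv ?_
    have : p + 1 ≠ 0 := by linarith
    field_simp
  have df := fun w => hasLineDerivAt_comp_optical (hasDerivAt_weightF β κ (optical e z)) w
  have dh := fun w => hasLineDerivAt_comp_optical (hasDerivAt_weightH β (optical e z)) w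
  have du := fun w => hasLineDerivAt_comp_optical (hasDerivAt_id (optical e z)) w
  have dy := fun w => hasLineDerivAt_apply 2 z w
  have dsh := fun w => hasLineDerivAt_comp_optical
    (((contDiff_shift β hκ).differentiable one_ne_zero (optical e z)).hasDerivAt) w
  have wU : frameU e 0 - e * frameU e 1 = 1 := by simp [frameU]; linarith
  have wV : frameV e 0 - e * frameV e 1 = 0 := by simp [frameV]; linarith
  have wY : frameY 0 - e * frameY 1 = 0 := by simp [frameY]
  have yU : frameU e 2 = 0 := rfl
  have yV : frameV e 2 = 0 := rfl
  have yY : frameY 2 = 1 := rfl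
  have Va : covDir A (frameV e) (modDerivU β κ e φ A) z =
      covDir A (frameV e) (covDir A (frameU e) φ) z +
        shift β κ (optical e z) * covDir A (frameV e) φ z := by
    have h : covDir A (frameV e) (modDerivU β κ e φ A) z = _ :=
      covDir_add_smul da₀ ds dφ (dsh (frameV e))
    rw [h, wV, mul_zero, Complex.ofReal_zero, zero_mul, add_zero]
  have Ya : covDir A frameY (modDerivU β κ e φ A) z =
      covDir A frameY (covDir A (frameU e) φ) z +
        shift β κ (optical e z) * covDir A frameY φ z := by
    have h : covDir A frameY (modDerivU β κ e φ A) z = _ :=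
      covDir_add_smul da₀ ds dφ (dsh frameY)
    rw [h, wY, mul_zero, Complex.ofReal_zero, zero_mul, add_zero]
  have raa := fun w => hasLineDerivAt_rdot A da da w
  have rac := fun w => hasLineDerivAt_rdot A da dc w
  have rca := fun w => hasLineDerivAt_rdot A dc da w
  have rcc := fun w => hasLineDerivAt_rdot A dc dc w
  have rcb := fun w => hasLineDerivAt_rdot A dc db w
  have rab := fun w => hasLineDerivAt_rdot A da db w
  have rbb := fun w => hasLineDerivAt_rdot A db db w
  have hV := (cV.differentiable one_ne_zero z).hasFDerivAt.hasLineDerivAt (frameU e)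
  have hU := (cU.differentiable one_ne_zero z).hasFDerivAt.hasLineDerivAt (frameV e)
  have hY := (cY.differentiable one_ne_zero z).hasFDerivAt.hasLineDerivAt frameY
  unfold HasLineDerivAt at *
  have eV := hV.unique
    ((((df (frameU e)).mul (((rcc (frameU e)).div_const 4).add (dV (frameU e)))).add
      ((((dy (frameU e)).mul (du (frameU e))).mul (dh (frameU e))).mul (rcb (frameU e)))).add
      ((((dy (frameU e)).pow 2).mul (dh (frameU e))).mul (rbb (frameU e))))
  have eU := hU.unique
    ((((df (frameV e)).mul (raa (frameV e))).add
      ((((dy (frameV e)).mul (du (frameV e))).mul (dh (frameV e))).mul (rac (frameV e)))).add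
      ((((dy (frameV e)).pow 2).mul (dh (frameV e))).mul
        (((rcc (frameV e)).div_const 4).add (dV (frameV e)))))
  have eY := hY.unique
    ((((df frameY).mul (rca frameY)).add
      ((((dy frameY).mul (du frameY)).mul (dh frameY)).mul
        ((((rcc frameY).div_const 2).add ((rab frameY).const_mul 2)).sub
          ((dV frameY).const_mul 2)))).add
      ((((dy frameY).pow 2).mul (dh frameY)).mul (rcb frameY)))
  have key := stress_divergence e (‖φ z‖ ^ (p - 1)) (potential p φ z) (z 2)
    (weightF β κ (optical e z)) (weightF' β κ (optical e z))
    (weightH β (optical e z)) (weightH' β (optical e z))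
    (optical e z * weightH β (optical e z))
    (weightH β (optical e z) + optical e z * weightH' β (optical e z))
    (shift β κ (optical e z)) (φ z) _ _ _ _ _ _ _ _ _ _
    (shift_mul_weightF β hκ _) (frame_wave hs he hz) (frame_comm_UV hs e hz)
    (frame_comm_UY hs he hz) (frame_comm_VY hs he hz)
  have hW : ‖φ z‖ ^ (p - 1) * rdot (φ z) (φ z) = ‖φ z‖ ^ (p + 1) := by
    have h1 : rdot (φ z) (φ z) = ‖φ z‖ ^ 2 := by
      rw [Complex.sq_norm, Complex.normSq_apply]; rfl
    rw [h1, ← Real.rpow_natCast, ← Real.rpow_add' (norm_nonneg _) (by push_cast; linarith)]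
    congr 1; push_cast; ring
  have fin := divergence_nonneg hp hβ hβ' hκ hκ' (optical e z) (z 2)
    (W := ‖φ z‖ ^ (p + 1)) (by positivity) (covDir A (frameV e) φ z) (covDir A frameY φ z)
  have hg := shift_mul_weightF β hκ (optical e z)
  rw [eV, eU, eY]
  refine fin.trans_eq ?_
  simp only [Pi.mul_apply, Pi.add_apply, Pi.sub_apply, Pi.pow_apply, Pi.zero_apply, zero_smul,
    add_zero, id, wU, wV, wY, yU, yV, yY, Va, Ya]
  simp only [modDerivU]
  unfold potential at key ⊢
  linear_combination -key - (optical e z * weightH β (optical e z) / 2) * hW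
    + (‖φ z‖ ^ (p - 1) * rdot (φ z) (φ z) / 2) * hg

/-! ### The localized energy inequality -/

/-- Divergence theorem in a slab, for a vector field of nonnegative divergence that vanishes on the
lateral boundary. -/
theorem slab_integral_le {F : Fin 3 → Spacetime → ℝ} (hF : ∀ i, ContDiff ℝ 1 (F i)) {T R : ℝ}
    (hT : 0 ≤ T) (hR : 0 ≤ R)
    (h1 : ∀ z : Spacetime, 0 ≤ z 0 → |z 1| = R → F 1 z = 0)
    (h2 : ∀ z : Spacetime, 0 ≤ z 0 → |z 2| = R → F 2 z = 0)
    (hdiv : ∀ z : Spacetime, 0 ≤ z 0 → 0 ≤ ∑ i, pd i (F i) z) :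
    ∫ y in Set.Icc (fun _ : Fin 2 => -R) (fun _ => R), F 0 ![0, y 0, y 1] ≤
      ∫ y in Set.Icc (fun _ : Fin 2 => -R) (fun _ => R), F 0 ![T, y 0, y 1] := by
  set a : Spacetime := ![0, -R, -R]
  set b : Spacetime := ![T, R, R]
  have hab : a ≤ b := by
    intro i; fin_cases i <;> simp [a, b] <;> linarith
  have hcont : Continuous fun z => ∑ i, pd i (F i) z := by
    unfold pd
    exact continuous_finsetSum _ fun i _ =>
      ((hF i).continuous_fderiv one_ne_zero).clm_apply continuous_const
  have key := integral_divergence_of_hasFDerivAt_off_countable' a b hab F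
    (fun i z => fderiv ℝ (F i) z) ∅ Set.countable_empty
    (fun i => (hF i).continuous.continuousOn)
    (fun z _ i => ((hF i).differentiable one_ne_zero z).hasFDerivAt)
    (hcont.continuousOn.integrableOn_compact isCompact_Icc)
  have hpos : 0 ≤ ∫ z in Set.Icc a b, ∑ i, fderiv ℝ (F i) z (Pi.single i 1) :=
    setIntegral_nonneg measurableSet_Icc fun z hz => hdiv z (hz.1 0)
  rw [key] at hpos
  have side : ∀ (i : Fin 3) (c : ℝ), i ≠ 0 → |c| = R →
      ∫ y in Set.Icc (a ∘ i.succAbove) (b ∘ i.succAbove), F i (i.insertNth c y) = 0 := by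
    intro i c hi hc
    refine setIntegral_eq_zero_of_forall_eq_zero fun y hy => ?_
    have h0 : (0 : ℝ) ≤ (i.insertNth c y : Spacetime) 0 := by
      have h := hy.1 0
      have e : i.succAbove 0 = 0 := by fin_cases i <;> simp_all
      have := Fin.insertNth_apply_succAbove (α := fun _ => ℝ) i c y 0
      rw [e] at this
      rw [this]
      simpa [e, a] using h
    have hi' : |(i.insertNth c y : Spacetime) i| = R := by simpa using hc
    fin_cases i
    · exact absurd rfl hi
    · exact h1 _ h0 hi'
    · exact h2 _ h0 hi'
  have e1 := side 1 (a 1) (by simp) (by simp [a, abs_of_nonneg hR])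
  have e2 := side 1 (b 1) (by simp) (by simp [b, abs_of_nonneg hR])
  have e3 := side 2 (a 2) (by simp) (by simp [a, abs_of_nonneg hR])
  have e4 := side 2 (b 2) (by simp) (by simp [b, abs_of_nonneg hR])
  rw [Fin.sum_univ_three, e1, e2, e3, e4] at hpos
  have fa : a ∘ Fin.succAbove 0 = fun _ : Fin 2 => -R := by
    ext i; fin_cases i <;> simp [a]
  have fb : b ∘ Fin.succAbove 0 = fun _ : Fin 2 => R := by
    ext i; fin_cases i <;> simp [b]
  have ins : ∀ (c : ℝ) (y : Fin 2 → ℝ), (Fin.insertNth 0 c y : Spacetime) = ![c, y 0, y 1] := by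
    intro c y; ext i; fin_cases i <;> rfl
  simp only [fa, fb, ins] at hpos
  simp only [a, b, Matrix.cons_val_zero] at hpos
  linarith

/-- A smoothed spatial radius. -/
noncomputable def radius (z : Spacetime) : ℝ := √(1 + z 1 ^ 2 + z 2 ^ 2)

/-- The cutoff `(1 - (t + ⟨x⟩) / R)₊²`, which is nonincreasing along future causal directions and
supported in a backward light cone. -/
noncomputable def cutoff (R : ℝ) (z : Spacetime) : ℝ := max (1 - (z 0 + radius z) / R) 0 ^ 2

theorem radius_pos (z : Spacetime) : 0 < radius z := by
  unfold radius; positivity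

theorem radius_sq (z : Spacetime) : radius z ^ 2 = 1 + z 1 ^ 2 + z 2 ^ 2 :=
  Real.sq_sqrt (by positivity)

theorem contDiff_radius : ContDiff ℝ 1 radius := by
  unfold radius
  exact ContDiff.sqrt (by fun_prop) fun z => by positivity

theorem contDiff_cutoff (R : ℝ) : ContDiff ℝ 1 (cutoff R) := by
  have h := contDiff_radius
  exact contDiff_max_zero_sq.comp (g := fun u : ℝ => max u 0 ^ 2)
    (f := fun z => 1 - (z 0 + radius z) / R) (by fun_prop)

theorem cutoff_nonneg (R : ℝ) (z : Spacetime) : 0 ≤ cutoff R z := sq_nonneg _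

theorem cutoff_le_one {R : ℝ} (hR : 0 < R) {z : Spacetime} (hz : 0 ≤ z 0) : cutoff R z ≤ 1 := by
  have h := radius_pos z
  have h1 : max (1 - (z 0 + radius z) / R) 0 ≤ 1 :=
    max_le (by linarith [div_nonneg (add_nonneg hz h.le) hR.le]) zero_le_one
  exact pow_le_one₀ (le_max_right _ _) h1

theorem cutoff_eq_zero {R : ℝ} (hR : 0 < R) {z : Spacetime} (hz : 0 ≤ z 0)
    (h : R ≤ |z 1| ∨ R ≤ |z 2|) : cutoff R z = 0 := by
  have h1 : R ≤ radius z := by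
    rcases h with h | h
    · refine h.trans (Real.abs_le_sqrt ?_); nlinarith [sq_nonneg (z 2)]
    · refine h.trans (Real.abs_le_sqrt ?_); nlinarith [sq_nonneg (z 1)]
  have h2 : 1 ≤ (z 0 + radius z) / R := by rw [le_div_iff₀ hR]; linarith
  unfold cutoff
  rw [max_eq_right (by linarith)]; norm_num

theorem pd_radius (z : Spacetime) :
    pd 0 radius z = 0 ∧ pd 1 radius z = z 1 / radius z ∧ pd 2 radius z = z 2 / radius z := by
  have hr := radius_pos z
  have h : HasFDerivAt radius _ z := HasFDerivAt.sqrt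
    (((hasFDerivAt_apply (𝕜 := ℝ) 1 z).pow 2 |>.const_add 1).add ((hasFDerivAt_apply 2 z).pow 2))
    (by simp; positivity)
  have e : √(1 + z 1 ^ 2 + z 2 ^ 2) = radius z := rfl
  unfold pd
  rw [h.fderiv]
  refine ⟨?_, ?_, ?_⟩ <;> simp [e] <;> field_simp

theorem pd_cutoff {R : ℝ} (z : Spacetime) (i : Fin 3) :
    pd i (cutoff R) z =
      -(2 * max (1 - (z 0 + radius z) / R) 0 / R) * (pd i (fun z => z 0) z + pd i radius z) := by
  have h1 : HasFDerivAt radius _ z := (contDiff_radius.differentiable one_ne_zero z).hasFDerivAt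
  have h0 : HasFDerivAt (fun z : Spacetime => z 0) _ z := hasFDerivAt_apply (𝕜 := ℝ) 0 z
  have h2 := ((h0.add h1).mul_const (R⁻¹)).const_sub 1
  have h : HasFDerivAt (cutoff R) _ z :=
    (hasDerivAt_max_zero_sq (1 - (z 0 + radius z) / R)).comp_hasFDerivAt z
      (f := fun z => 1 - (z 0 + radius z) / R) h2
  unfold pd
  rw [h.fderiv, h0.fderiv]
  simp [div_eq_mul_inv]
  ring

/-- The energy density of the multiplier on the slices `t = const`. -/
noncomputable def energyDensity (p β κ e : ℝ) (φ : Spacetime → ℂ) (A : Fin 3 → Spacetime → ℝ)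
    (z : Spacetime) : ℝ := currentU p β κ e φ A z + currentV p β κ e φ A z

/-- The splitting `f = u² h + δ` with `δ ≥ 0`, which decomposes the multiplier into `h` times a null
vector and a multiple `δ ∂_u` of a null vector. -/
theorem weightF_eq_add (β κ u : ℝ) :
    weightF β κ u = u ^ 2 * weightH β u + (weightH β u + (κ - 1) * min u 0 ^ 2) := by
  unfold weightF; ring

theorem potential_nonneg (hp : 1 < p) (z : Spacetime) : 0 ≤ potential p φ z := by
  unfold potential
  have : 0 < p + 1 := by linarith
  positivity

/-- The current is nonnegative on the causal covectors `(l, m, n)` of the null frame. -/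
theorem current_dominant (hp : 1 < p) (hκ : 1 ≤ κ) {l m n : ℝ} (hl : 0 ≤ l) (hm : 0 ≤ m)
    (hn : n ^ 2 ≤ l * m) (z : Spacetime) :
    0 ≤ l * currentU p β κ e φ A z + m * currentV p β κ e φ A z
      - n * currentY p β κ e φ A z := by
  have hh := (weightH_pos β (optical e z)).le
  have := stress_dominant (u := optical e z) (y := z 2) hh
    (add_nonneg hh (mul_nonneg (sub_nonneg.2 hκ) (sq_nonneg (min (optical e z) 0))))
    (potential_nonneg (φ := φ) hp z) hl hm hn (modDerivU β κ e φ A z) (covDir A (frameV e) φ z)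
    (covDir A frameY φ z)
  rw [← weightF_eq_add] at this
  exact this

theorem energyDensity_nonneg (hp : 1 < p) (hκ : 1 ≤ κ) (z : Spacetime) :
    0 ≤ energyDensity p β κ e φ A z := by
  have := current_dominant (β := β) (e := e) (φ := φ) (A := A) hp hκ zero_le_one zero_le_one
    (n := 0) (by norm_num) z
  unfold energyDensity; linarith

theorem contDiff_energyDensity (hp : 1 < p) (hs : IsSolution p φ₀ φ₁ φ A) (hκ : 1 ≤ κ) :
    ContDiff ℝ 1 (energyDensity p β κ e φ A) := by
  obtain ⟨h1, h2, -⟩ := contDiff_currents (β := β) (e := e) hp hs hκ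
  exact h1.add h2

/-- The current stays of nonnegative divergence after multiplication by the cutoff, because the
gradient of the cutoff is causal. -/
theorem localized_divergence_nonneg (hp : 1 < p) (hβ : 0 ≤ β) (hβ' : 2 - β ≤ (p - 1) / 2)
    (hκ : 1 ≤ κ) (hκ' : (p - 1) / 4 ≤ κ) (he : e ^ 2 = 1) (hs : IsSolution p φ₀ φ₁ φ A)
    {R : ℝ} (hR : 0 < R) {z : Spacetime} (hz : 0 ≤ z 0) :
    0 ≤ pd 0 (fun z => cutoff R z * -energyDensity p β κ e φ A z) z
      + pd 1 (fun z => cutoff R z * (e * (currentV p β κ e φ A z - currentU p β κ e φ A z))) z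
      + pd 2 (fun z => cutoff R z * currentY p β κ e φ A z) z := by
  obtain ⟨cU, cV, cY⟩ := contDiff_currents (β := β) (e := e) hp hs hκ
  have dη := ((contDiff_cutoff R).differentiable one_ne_zero z).hasFDerivAt
  have dU := (cU.differentiable one_ne_zero z).hasFDerivAt
  have dV := (cV.differentiable one_ne_zero z).hasFDerivAt
  have dY := (cY.differentiable one_ne_zero z).hasFDerivAt
  have h0 : HasFDerivAt (fun z => cutoff R z * -energyDensity p β κ e φ A z) _ z :=
    dη.mul (dU.add dV).neg
  have h1 : HasFDerivAt
      (fun z => cutoff R z * (e * (currentV p β κ e φ A z - currentU p β κ e φ A z))) _ z :=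
    dη.mul ((dV.sub dU).const_mul e)
  have h2 : HasFDerivAt (fun z => cutoff R z * currentY p β κ e φ A z) _ z := dη.mul dY
  have nul := null_divergence_nonneg hp hβ hβ' hκ hκ' he hs hz
  obtain ⟨r0, r1, r2⟩ := pd_radius z
  have t0 : pd 0 (fun z : Spacetime => z 0) z = 1 := by
    simp [pd, (hasFDerivAt_apply (𝕜 := ℝ) (0 : Fin 3) z).fderiv]
  have t1 : pd 1 (fun z : Spacetime => z 0) z = 0 := by
    simp [pd, (hasFDerivAt_apply (𝕜 := ℝ) (0 : Fin 3) z).fderiv]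
  have t2 : pd 2 (fun z : Spacetime => z 0) z = 0 := by
    simp [pd, (hasFDerivAt_apply (𝕜 := ℝ) (0 : Fin 3) z).fderiv]
  have c0 := pd_cutoff (R := R) z 0
  have c1 := pd_cutoff (R := R) z 1
  have c2 := pd_cutoff (R := R) z 2
  rw [t0, r0] at c0
  rw [t1, r1] at c1
  rw [t2, r2] at c2
  set k := 2 * max (1 - (z 0 + radius z) / R) 0 / R with hk
  have hk0 : 0 ≤ k := by
    have := le_max_right (1 - (z 0 + radius z) / R) 0
    positivity
  have hr := radius_pos z
  have hr2 := radius_sq z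
  set n₁ := z 1 / radius z
  set n₂ := z 2 / radius z
  have hn : n₁ ^ 2 + n₂ ^ 2 ≤ 1 := by
    simp only [n₁, n₂, div_pow, ← add_div]
    rw [div_le_one (by positivity)]; linarith
  have hen : (e * n₁) ^ 2 ≤ 1 := by rw [mul_pow, he]; nlinarith [sq_nonneg n₂]
  have habs := abs_le.1 ((sq_le_one_iff_abs_le_one _).1 hen)
  have dom := current_dominant (β := β) (e := e) (φ := φ) (A := A) hp hκ
    (l := 1 + e * n₁) (m := 1 - e * n₁) (n := n₂) (by linarith [habs.1]) (by linarith [habs.2])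
    (by nlinarith) z
  rw [fderiv_eq_sum_pd, fderiv_eq_sum_pd, fderiv_eq_sum_pd] at nul
  simp only [Fin.sum_univ_three, frameU, frameV, frameY, smul_eq_mul, Matrix.cons_val_zero,
    Matrix.cons_val_one, Matrix.cons_val] at nul
  have hnul := mul_nonneg (cutoff_nonneg R z) nul
  have hdom := mul_nonneg hk0 dom
  unfold pd at *
  rw [h0.fderiv, h1.fderiv, h2.fderiv]
  simp only [add_apply, FunLike.coe_smul, Pi.smul_apply, smul_eq_mul,
    neg_apply, sub_apply, c0, c1, c2]
  unfold energyDensity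
  linarith

/-- The localized energy at time `T` is at most the full initial energy. -/
theorem localized_energy_le (hp : 1 < p) (hβ : 0 ≤ β) (hβ' : 2 - β ≤ (p - 1) / 2)
    (hκ : 1 ≤ κ) (hκ' : (p - 1) / 4 ≤ κ) (he : e ^ 2 = 1) (hs : IsSolution p φ₀ φ₁ φ A)
    {R T : ℝ} (hR : 0 < R) (hT : 0 ≤ T) :
    ∫⁻ y : Fin 2 → ℝ, ENNReal.ofReal
        (cutoff R ![T, y 0, y 1] * energyDensity p β κ e φ A ![T, y 0, y 1]) ≤
      ∫⁻ y : Fin 2 → ℝ, ENNReal.ofReal (energyDensity p β κ e φ A ![0, y 0, y 1]) := by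
  obtain ⟨cU, cV, cY⟩ := contDiff_currents (β := β) (e := e) hp hs hκ
  have cη := contDiff_cutoff R
  have cE := contDiff_energyDensity (β := β) (e := e) hp hs hκ
  have main := slab_integral_le
    (F := ![fun z => cutoff R z * -energyDensity p β κ e φ A z,
      fun z => cutoff R z * (e * (currentV p β κ e φ A z - currentU p β κ e φ A z)),
      fun z => cutoff R z * currentY p β κ e φ A z])
    (fun i => by fin_cases i <;> simp <;> fun_prop) hT hR.le
    (fun z hz h => by simp [cutoff_eq_zero hR hz (Or.inl h.ge)])
    (fun z hz h => by simp [cutoff_eq_zero hR hz (Or.inr h.ge)])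
    (fun z hz => by
      rw [Fin.sum_univ_three]
      exact localized_divergence_nonneg hp hβ hβ' hκ hκ' he hs hR hz)
  simp only [Matrix.cons_val_zero, mul_neg, integral_neg, neg_le_neg_iff] at main
  have nn : ∀ z, 0 ≤ cutoff R z * energyDensity p β κ e φ A z := fun z =>
    mul_nonneg (cutoff_nonneg R z) (energyDensity_nonneg hp hκ z)
  have ev : ∀ t : ℝ, Continuous fun y : Fin 2 → ℝ => (![t, y 0, y 1] : Spacetime) := by
    intro t
    refine continuous_pi fun i => ?_
    fin_cases i <;> simp <;> fun_prop
  have int : ∀ t : ℝ, IntegrableOn (fun y : Fin 2 → ℝ =>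
      cutoff R ![t, y 0, y 1] * energyDensity p β κ e φ A ![t, y 0, y 1])
      (Set.Icc (fun _ : Fin 2 => -R) (fun _ => R)) := fun t =>
    (((cη.continuous.mul cE.continuous).comp (ev t)).continuousOn).integrableOn_compact
      isCompact_Icc
  have conv : ∀ t : ℝ, ENNReal.ofReal (∫ y in Set.Icc (fun _ : Fin 2 => -R) (fun _ => R),
      cutoff R ![t, y 0, y 1] * energyDensity p β κ e φ A ![t, y 0, y 1]) =
      ∫⁻ y in Set.Icc (fun _ : Fin 2 => -R) (fun _ => R), ENNReal.ofReal
      (cutoff R ![t, y 0, y 1] * energyDensity p β κ e φ A ![t, y 0, y 1]) := fun t =>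
    ofReal_integral_eq_lintegral_ofReal (int t) (Filter.Eventually.of_forall fun y => nn _)
  have main' := ENNReal.ofReal_le_ofReal main
  rw [conv, conv] at main'
  have supp : ∫⁻ y in Set.Icc (fun _ : Fin 2 => -R) (fun _ => R), ENNReal.ofReal
      (cutoff R ![T, y 0, y 1] * energyDensity p β κ e φ A ![T, y 0, y 1]) =
      ∫⁻ y : Fin 2 → ℝ, ENNReal.ofReal
        (cutoff R ![T, y 0, y 1] * energyDensity p β κ e φ A ![T, y 0, y 1]) := by
    refine setLIntegral_eq_of_support_subset ?_
    intro y hy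
    by_contra hc
    refine hy ?_
    have : R ≤ |y 0| ∨ R ≤ |y 1| := by
      by_contra! h
      refine hc ⟨fun i => ?_, fun i => ?_⟩ <;> fin_cases i
      · exact (abs_lt.1 h.1).1.le
      · exact (abs_lt.1 h.2).1.le
      · exact (abs_lt.1 h.1).2.le
      · exact (abs_lt.1 h.2).2.le
    have h0 : cutoff R ![T, y 0, y 1] = 0 :=
      cutoff_eq_zero hR (by simpa using hT) (by simpa using this)
    simp [h0]
  rw [supp] at main'
  refine main'.trans ((setLIntegral_le_lintegral _ _).trans (lintegral_mono fun y => ?_))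
  refine ENNReal.ofReal_le_ofReal ?_
  exact mul_le_of_le_one_left (energyDensity_nonneg hp hκ _) (cutoff_le_one hR (by simp))

/-- The energy at time `T` is at most the initial energy. -/
theorem energy_le (hp : 1 < p) (hβ : 0 ≤ β) (hβ' : 2 - β ≤ (p - 1) / 2)
    (hκ : 1 ≤ κ) (hκ' : (p - 1) / 4 ≤ κ) (he : e ^ 2 = 1) (hs : IsSolution p φ₀ φ₁ φ A)
    {T : ℝ} (hT : 0 ≤ T) :
    ∫⁻ y : Fin 2 → ℝ, ENNReal.ofReal (energyDensity p β κ e φ A ![T, y 0, y 1]) ≤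
      ∫⁻ y : Fin 2 → ℝ, ENNReal.ofReal (energyDensity p β κ e φ A ![0, y 0, y 1]) := by
  have cE := contDiff_energyDensity (β := β) (e := e) hp hs hκ
  have ev : ∀ t : ℝ, Continuous fun y : Fin 2 → ℝ => (![t, y 0, y 1] : Spacetime) := by
    intro t
    refine continuous_pi fun i => ?_
    fin_cases i <;> simp <;> fun_prop
  have lim : ∀ z : Spacetime, Filter.Tendsto (fun n : ℕ => ENNReal.ofReal
      (cutoff (n + 1) z * energyDensity p β κ e φ A z)) Filter.atTop
      (nhds (ENNReal.ofReal (energyDensity p β κ e φ A z))) := by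
    intro z
    refine (ENNReal.continuous_ofReal.tendsto _).comp ?_
    have h1 : Filter.Tendsto (fun n : ℕ => (z 0 + radius z) / ((n : ℝ) + 1)) Filter.atTop
        (nhds 0) := by
      simpa [Function.comp_def] using
        (tendsto_const_div_atTop_nhds_zero_nat (z 0 + radius z)).comp
          (Filter.tendsto_add_atTop_nat 1)
    have h2 : Filter.Tendsto (fun n : ℕ => cutoff (n + 1) z) Filter.atTop
        (nhds (max (1 - 0) 0 ^ 2)) := ((h1.const_sub 1).max tendsto_const_nhds).pow 2
    simpa using h2.mul_const (energyDensity p β κ e φ A z)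
  calc ∫⁻ y : Fin 2 → ℝ, ENNReal.ofReal (energyDensity p β κ e φ A ![T, y 0, y 1])
      = ∫⁻ y : Fin 2 → ℝ, Filter.liminf (fun n : ℕ => ENNReal.ofReal
          (cutoff (n + 1) ![T, y 0, y 1] * energyDensity p β κ e φ A ![T, y 0, y 1]))
          Filter.atTop := lintegral_congr fun y => (lim _).liminf_eq.symm
    _ ≤ Filter.liminf (fun n : ℕ => ∫⁻ y : Fin 2 → ℝ, ENNReal.ofReal
          (cutoff (n + 1) ![T, y 0, y 1] * energyDensity p β κ e φ A ![T, y 0, y 1]))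
          Filter.atTop := lintegral_liminf_le fun n => by
            refine (ENNReal.continuous_ofReal.comp ?_).measurable
            exact ((contDiff_cutoff _).continuous.mul cE.continuous).comp (ev T)
    _ ≤ _ := by
      refine Filter.liminf_le_of_frequently_le' (Filter.Frequently.of_forall fun n => ?_)
      exact localized_energy_le hp hβ hβ' hκ hκ' he hs (by positivity) hT

/-! ### A weighted Hardy inequality in the plane -/

/-- The radial derivative in coordinates. -/
theorem sum_apply_mul_fderiv (q : Space → ℝ) (x : Space) :
    ∑ j, x j * fderiv ℝ q x (EuclideanSpace.single j 1) = fderiv ℝ q x x := by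
  have h : x = ∑ j, x j • (EuclideanSpace.single j 1 : Space) := by
    ext i; fin_cases i <;> simp
  conv_rhs => rw [h]
  rw [map_sum]
  conv_rhs => rw [← h]
  simp

/-- The radial vector field has divergence two. -/
theorem integral_radial_eq_zero {W q : Space → ℝ} (hW : ContDiff ℝ 1 W) (hWc : HasCompactSupport W)
    (hq : ContDiff ℝ 1 q) :
    ∫ x, (2 * W x * q x + fderiv ℝ W x x * q x + W x * fderiv ℝ q x x) = 0 := by
  have cj : ∀ j : Fin 2, ContDiff ℝ 1 (fun x : Space => x j) := fun j => by fun_prop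
  have cf : ∀ j : Fin 2, ContDiff ℝ 1 (fun x : Space => W x * x j) := fun j => hW.mul (cj j)
  have sf : ∀ j : Fin 2, HasCompactSupport (fun x : Space => W x * x j) := fun j => hWc.mul_right
  have cd : ∀ (f : Space → ℝ) (v : Space), ContDiff ℝ 1 f → Continuous fun x => fderiv ℝ f x v :=
    fun f v hf => (hf.continuous_fderiv one_ne_zero).clm_apply continuous_const
  have i1 : ∀ j : Fin 2, Integrable (fun x : Space =>
      fderiv ℝ (fun x : Space => W x * x j) x (EuclideanSpace.single j 1) * q x) := fun j =>
    ((cd _ _ (cf j)).mul hq.continuous).integrable_of_hasCompactSupport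
      (((sf j).fderiv_apply ℝ _).mul_right)
  have i2 : ∀ j : Fin 2, Integrable (fun x : Space =>
      W x * x j * fderiv ℝ q x (EuclideanSpace.single j 1)) := fun j =>
    ((cf j).continuous.mul (cd _ _ hq)).integrable_of_hasCompactSupport (sf j).mul_right
  have i3 : ∀ j : Fin 2, Integrable (fun x : Space => W x * x j * q x) := fun j =>
    ((cf j).continuous.mul hq.continuous).integrable_of_hasCompactSupport (sf j).mul_right
  have parts := fun j : Fin 2 => integral_mul_fderiv_eq_neg_fderiv_mul_of_integrable
    (i1 j) (i2 j) (i3 j) (fun x _ => (cf j).differentiable one_ne_zero x)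
    (fun x _ => hq.differentiable one_ne_zero x)
  have pt : ∀ x, 2 * W x * q x + fderiv ℝ W x x * q x + W x * fderiv ℝ q x x =
      ∑ j : Fin 2, (W x * x j * fderiv ℝ q x (EuclideanSpace.single j 1) +
        fderiv ℝ (fun x : Space => W x * x j) x (EuclideanSpace.single j 1) * q x) := by
    intro x
    have df : ∀ j : Fin 2, fderiv ℝ (fun x : Space => W x * x j) x (EuclideanSpace.single j 1) =
        W x + x j * fderiv ℝ W x (EuclideanSpace.single j 1) := by
      intro j
      rw [fderiv_fun_mul (hW.differentiable one_ne_zero x) ((cj j).differentiable one_ne_zero x)]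
      have : fderiv ℝ (fun x : Space => x j) x (EuclideanSpace.single j 1) = 1 := by
        have := (EuclideanSpace.proj j : Space →L[ℝ] ℝ).hasFDerivAt (x := x)
        have h : fderiv ℝ (fun x : Space => x j) x = _ := this.fderiv
        rw [h]; simp
      simp [this]
    simp only [df, ← sum_apply_mul_fderiv, Fin.sum_univ_two]
    ring
  simp_rw [pt]
  have i12 : ∀ j : Fin 2, Integrable (fun x : Space =>
      W x * x j * fderiv ℝ q x (EuclideanSpace.single j 1) +
        fderiv ℝ (fun x : Space => W x * x j) x (EuclideanSpace.single j 1) * q x) :=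
    fun j => (i2 j).add (i1 j)
  rw [integral_finsetSum _ fun j _ => i12 j]
  refine Finset.sum_eq_zero fun j _ => ?_
  rw [integral_add (i2 j) (i1 j), parts j]
  ring

/-- Hardy's inequality for a compactly supported weight. The weight `(1 + ε |x|²)^{-s/2}` decays
slowly enough for the radial multiplier, and the last integral is the error made by cutting it off
at `|x| ~ δ^{-1/2}`. -/
theorem hardy_cutoff {q d : Space → ℝ} (hq : ContDiff ℝ 1 q) (hq0 : ∀ x, 0 ≤ q x)
    (hd : Continuous d) (hd0 : ∀ x, 0 ≤ d x)
    (hqd : ∀ x, fderiv ℝ q x x ^ 2 ≤ 4 * q x * (‖x‖ ^ 2 * d x)) {s : ℝ} (hs0 : 0 ≤ s) (hs : s < 2)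
    {ε δ : ℝ} (hε : 0 < ε) (hδ : 0 < δ) :
    ∫⁻ x, ENNReal.ofReal ((1 + ε * ‖x‖ ^ 2) ^ (-s / 2) * max (1 - δ * ‖x‖ ^ 2) 0 ^ 2 * q x) ≤
      ENNReal.ofReal ((2 / (2 - s)) ^ 2) * (∫⁻ x, ENNReal.ofReal (‖x‖ ^ 2 * d x)) +
      ENNReal.ofReal (8 / (2 - s)) * ∫⁻ x, ENNReal.ofReal
        ((1 + ε * ‖x‖ ^ 2) ^ (-s / 2) * (δ * ‖x‖ ^ 2 * max (1 - δ * ‖x‖ ^ 2) 0) * q x) := by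
  set ω : Space → ℝ := fun x => (1 + ε * ‖x‖ ^ 2) ^ (-s / 2) with hω
  set M : Space → ℝ := fun x => max (1 - δ * ‖x‖ ^ 2) 0 with hM
  set W : Space → ℝ := fun x => ω x * M x ^ 2 with hW
  have hpos : ∀ x : Space, 0 < 1 + ε * ‖x‖ ^ 2 := fun x => by positivity
  have hω0 : ∀ x, 0 < ω x := fun x => Real.rpow_pos_of_pos (hpos x) _
  have hω1 : ∀ x, ω x ≤ 1 := fun x => Real.rpow_le_one_of_one_le_of_nonpos
    (by nlinarith [mul_nonneg hε.le (sq_nonneg ‖x‖)]) (by linarith)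
  have hM0 : ∀ x, 0 ≤ M x := fun x => le_max_right _ _
  have hM1 : ∀ x, M x ≤ 1 := fun x =>
    max_le (by nlinarith [mul_nonneg hδ.le (sq_nonneg ‖x‖)]) zero_le_one
  have cω : ContDiff ℝ 1 ω := ContDiff.rpow_const_of_ne
    (contDiff_const.add (contDiff_const.mul (contDiff_norm_sq ℝ))) fun x => (hpos x).ne'
  have cM : ContDiff ℝ 1 fun x => M x ^ 2 :=
    contDiff_max_zero_sq.comp (g := fun u : ℝ => max u 0 ^ 2)
      (f := fun x : Space => 1 - δ * ‖x‖ ^ 2)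
      (contDiff_const.sub (contDiff_const.mul (contDiff_norm_sq ℝ)))
  have cM' : Continuous M := by fun_prop
  have cW : ContDiff ℝ 1 W := cω.mul cM
  have sM : HasCompactSupport M := by
    refine HasCompactSupport.intro (isCompact_closedBall (0 : Space) (1 + 1 / δ)) fun x hx => ?_
    have h : 1 + 1 / δ < ‖x‖ := by simpa using hx
    have h2 : 1 / δ ≤ ‖x‖ ^ 2 := by
      have : 0 < 1 / δ := by positivity
      nlinarith
    refine max_eq_right ?_
    have := (div_le_iff₀' hδ).1 h2
    linarith
  have sW : HasCompactSupport W := by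
    have : HasCompactSupport fun x => ω x * M x * M x := sM.mul_left
    convert this using 2 with x
    simp only [hW]; ring
  -- `x · ∇W ≥ -(s M² + 4 δ |x|² M) ω`
  have dW : ∀ x, -(s * W x + 4 * (ω x * (δ * ‖x‖ ^ 2 * M x))) ≤ fderiv ℝ W x x := by
    intro x
    have hn := (hasStrictFDerivAt_norm_sq x).hasFDerivAt
    have h1 := (((hasDerivAt_id (‖x‖ ^ 2)).const_mul ε).const_add 1).rpow_const
      (p := -s / 2) (Or.inl (hpos x).ne')
    have h2 := (hasDerivAt_max_zero_sq (1 - δ * ‖x‖ ^ 2)).comp (‖x‖ ^ 2)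
      (((hasDerivAt_id (‖x‖ ^ 2)).const_mul δ).const_sub 1)
    have h12 : HasDerivAt
        (fun ρ => (1 + ε * ρ) ^ (-s / 2) * max (1 - δ * ρ) 0 ^ 2) _ (‖x‖ ^ 2) := h1.mul h2
    have h3 : HasFDerivAt W _ x := h12.comp_hasFDerivAt (f := fun x : Space => ‖x‖ ^ 2) x hn
    rw [h3.fderiv]
    have e1 : (1 + ε * ‖x‖ ^ 2) ^ (-s / 2 - 1) = ω x / (1 + ε * ‖x‖ ^ 2) := by
      rw [Real.rpow_sub_one (hpos x).ne']
    have e2 : ε * ‖x‖ ^ 2 / (1 + ε * ‖x‖ ^ 2) ≤ 1 := by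
      rw [div_le_one (hpos x)]; linarith
    have e3 := mul_le_mul_of_nonneg_left e2
      (mul_nonneg (mul_nonneg hs0 (hω0 x).le) (sq_nonneg (M x)))
    have e5 : (2 • innerSL ℝ x : Space →L[ℝ] ℝ) x = 2 * ‖x‖ ^ 2 := by
      simp [two_smul, two_mul]
    change _ ≤ (ε * 1 * (-s / 2) * (1 + ε * ‖x‖ ^ 2) ^ (-s / 2 - 1) * M x ^ 2
      + ω x * (2 * M x * -(δ * 1))) * ((2 • innerSL ℝ x : Space →L[ℝ] ℝ) x)
    rw [e5, e1]
    have e4 : (ε * 1 * (-s / 2) * (ω x / (1 + ε * ‖x‖ ^ 2)) * M x ^ 2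
      + ω x * (2 * M x * -(δ * 1))) * (2 * ‖x‖ ^ 2) =
      -(s * ω x * M x ^ 2 * (ε * ‖x‖ ^ 2 / (1 + ε * ‖x‖ ^ 2)))
        - 4 * (ω x * (δ * ‖x‖ ^ 2 * M x)) := by
      ring
    rw [e4]
    simp only [hW]
    linarith
  have hs' : 0 < 2 - s := by linarith
  set E : Space → ℝ := fun x => ω x * (δ * ‖x‖ ^ 2 * M x) * q x with hE
  have hE0 : ∀ x, 0 ≤ E x := fun x => by
    have := (hω0 x).le; have := hM0 x; have := hq0 x
    simp only [hE]; positivity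
  have pt : ∀ x, W x * q x ≤ (2 / (2 - s)) ^ 2 * (W x * (‖x‖ ^ 2 * d x)) + 8 / (2 - s) * E x
      + 2 / (2 - s) * (2 * W x * q x + fderiv ℝ W x x * q x + W x * fderiv ℝ q x x) := by
    intro x
    have hW0 : 0 ≤ W x := mul_nonneg (hω0 x).le (sq_nonneg _)
    have h1 := mul_le_mul_of_nonneg_right (dW x) (hq0 x)
    -- the arithmetic-geometric mean inequality for the cross term
    have h2 : -((2 - s) / 2 * q x + 2 / (2 - s) * (‖x‖ ^ 2 * d x)) ≤ fderiv ℝ q x x := by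
      have a0 : 0 ≤ (2 - s) / 2 * q x := mul_nonneg (by linarith) (hq0 x)
      have b0 : 0 ≤ 2 / (2 - s) * (‖x‖ ^ 2 * d x) := by have := hd0 x; positivity
      have hab : (2 - s) / 2 * q x * (2 / (2 - s) * (‖x‖ ^ 2 * d x)) = q x * (‖x‖ ^ 2 * d x) := by
        field_simp
      refine neg_le_of_abs_le (abs_le_of_sq_le_sq ?_ (by linarith))
      refine (hqd x).trans ?_
      nlinarith [sq_nonneg ((2 - s) / 2 * q x - 2 / (2 - s) * (‖x‖ ^ 2 * d x))]
    have h3 := mul_le_mul_of_nonneg_left h2 hW0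
    have h4 : (2 - s) / 2 * (W x * q x) ≤ 2 / (2 - s) * (W x * (‖x‖ ^ 2 * d x)) + 4 * E x
        + (2 * W x * q x + fderiv ℝ W x x * q x + W x * fderiv ℝ q x x) := by
      simp only [hE]; linarith
    have h5 := mul_le_mul_of_nonneg_left h4 (by positivity : 0 ≤ 2 / (2 - s))
    have e1 : 2 / (2 - s) * ((2 - s) / 2 * (W x * q x)) = W x * q x := by field_simp
    rw [e1] at h5
    refine h5.trans_eq ?_
    ring
  have cd : ∀ f : Space → ℝ, ContDiff ℝ 1 f → Continuous fun x => fderiv ℝ f x x :=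
    fun f hf => (hf.continuous_fderiv one_ne_zero).clm_apply continuous_id
  have I1 : Integrable fun x => W x * q x :=
    (cW.continuous.mul hq.continuous).integrable_of_hasCompactSupport sW.mul_right
  have I2 : Integrable fun x => W x * (‖x‖ ^ 2 * d x) :=
    (cW.continuous.mul (by fun_prop)).integrable_of_hasCompactSupport sW.mul_right
  have cE : Continuous E := (cω.continuous.mul (by fun_prop)).mul hq.continuous
  have I3 : Integrable E := by
    refine cE.integrable_of_hasCompactSupport ?_
    have : HasCompactSupport fun x => ω x * (δ * ‖x‖ ^ 2) * M x * q x := sM.mul_left.mul_right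
    rwa [show E = fun x => ω x * (δ * ‖x‖ ^ 2) * M x * q x from
      funext fun x => by simp only [hE]; ring]
  have sdW : HasCompactSupport fun x => fderiv ℝ W x x := by
    refine (sW.fderiv ℝ).mono' ?_
    refine (Function.support_subset_iff'.2 fun x hx => ?_).trans subset_closure
    have : fderiv ℝ W x = 0 := by simpa using hx
    simp [this]
  have I4 : Integrable fun x =>
      2 * W x * q x + fderiv ℝ W x x * q x + W x * fderiv ℝ q x x := by
    refine Integrable.add (Integrable.add ?_ ?_) ?_
    · simpa [mul_assoc] using I1.const_mul 2
    · exact ((cd W cW).mul hq.continuous).integrable_of_hasCompactSupport sdW.mul_right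
    · exact (cW.continuous.mul (cd q hq)).integrable_of_hasCompactSupport sW.mul_right
  have I5 : Integrable fun x => (2 / (2 - s)) ^ 2 * (W x * (‖x‖ ^ 2 * d x)) + 8 / (2 - s) * E x :=
    (I2.const_mul _).add (I3.const_mul _)
  have I6 : Integrable fun x => (2 / (2 - s)) ^ 2 * (W x * (‖x‖ ^ 2 * d x)) + 8 / (2 - s) * E x
      + 2 / (2 - s) * (2 * W x * q x + fderiv ℝ W x x * q x + W x * fderiv ℝ q x x) :=
    I5.add (I4.const_mul _)
  have main := integral_mono I1 I6 pt
  have e1 : ∫ x, ((2 / (2 - s)) ^ 2 * (W x * (‖x‖ ^ 2 * d x)) + 8 / (2 - s) * E x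
      + 2 / (2 - s) * (2 * W x * q x + fderiv ℝ W x x * q x + W x * fderiv ℝ q x x)) =
      (2 / (2 - s)) ^ 2 * (∫ x, W x * (‖x‖ ^ 2 * d x)) + 8 / (2 - s) * ∫ x, E x := by
    rw [integral_add I5 (I4.const_mul _),
      integral_add (I2.const_mul _) (I3.const_mul _), integral_const_mul, integral_const_mul,
      integral_const_mul, integral_radial_eq_zero cW sW hq]
    ring
  have main' := ENNReal.ofReal_le_ofReal (main.trans_eq e1)
  have n2 : ∀ x, 0 ≤ W x * (‖x‖ ^ 2 * d x) := fun x => by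
    have := (hω0 x).le; have := hM0 x; have := hd0 x
    simp only [hW]; positivity
  have n1 : ∀ x, 0 ≤ W x * q x := fun x =>
    mul_nonneg (mul_nonneg (hω0 x).le (sq_nonneg _)) (hq0 x)
  rw [ENNReal.ofReal_add (mul_nonneg (by positivity) (integral_nonneg n2))
    (mul_nonneg (by positivity) (integral_nonneg hE0)), ENNReal.ofReal_mul (by positivity),
    ENNReal.ofReal_mul (by positivity),
    ofReal_integral_eq_lintegral_ofReal I1 (Filter.Eventually.of_forall n1),
    ofReal_integral_eq_lintegral_ofReal I2 (Filter.Eventually.of_forall n2),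
    ofReal_integral_eq_lintegral_ofReal I3 (Filter.Eventually.of_forall hE0)] at main'
  refine main'.trans (add_le_add ?_ le_rfl)
  refine mul_le_mul' le_rfl (lintegral_mono fun x => ENNReal.ofReal_le_ofReal ?_)
  refine mul_le_of_le_one_left (mul_nonneg (sq_nonneg _) (hd0 x)) ?_
  exact mul_le_one₀ (hω1 x) (sq_nonneg _) (pow_le_one₀ (hM0 x) (hM1 x))

/-- Weighted Hardy inequality `‖f‖_{L²} ≲ ‖|x| ∇f‖_{L²}` in the plane, written for `q = |f|²` and
`d = |∇f|²`. Some decay of `q` has to be assumed, to exclude constants. -/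
theorem hardy {q d : Space → ℝ} (hq : ContDiff ℝ 1 q) (hq0 : ∀ x, 0 ≤ q x)
    (hd : Continuous d) (hd0 : ∀ x, 0 ≤ d x)
    (hqd : ∀ x, fderiv ℝ q x x ^ 2 ≤ 4 * q x * (‖x‖ ^ 2 * d x)) {s : ℝ} (hs0 : 0 ≤ s) (hs : s < 2)
    (hint : Integrable fun x : Space => (1 + ‖x‖ ^ 2) ^ (-s / 2) * q x) :
    ∫⁻ x, ENNReal.ofReal (q x) ≤
      ENNReal.ofReal ((2 / (2 - s)) ^ 2) * ∫⁻ x, ENNReal.ofReal (‖x‖ ^ 2 * d x) := by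
  have hqm : Continuous q := hq.continuous
  have u0 : Filter.Tendsto (fun n : ℕ => 1 / ((n : ℝ) + 1)) Filter.atTop (nhds 0) :=
    tendsto_one_div_add_atTop_nhds_zero_nat
  have cω : ∀ ε : ℝ, 0 ≤ ε → Continuous fun x : Space => (1 + ε * ‖x‖ ^ 2) ^ (-s / 2) :=
    fun ε hε => Continuous.rpow_const (by fun_prop) fun x => Or.inl (by positivity)
  -- First the cutoff is removed at fixed `ε`.
  have step : ∀ ε : ℝ, 0 < ε → ε ≤ 1 →
      ∫⁻ x, ENNReal.ofReal ((1 + ε * ‖x‖ ^ 2) ^ (-s / 2) * q x) ≤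
        ENNReal.ofReal ((2 / (2 - s)) ^ 2) * ∫⁻ x, ENNReal.ofReal (‖x‖ ^ 2 * d x) := by
    intro ε hε hε1
    have hω0 : ∀ x : Space, 0 ≤ (1 + ε * ‖x‖ ^ 2) ^ (-s / 2) := fun x => by positivity
    have mM : ∀ a : ℝ, Continuous fun x : Space => max (1 - a * ‖x‖ ^ 2) 0 := fun a => by fun_prop
    have limM : ∀ x : Space, Filter.Tendsto
        (fun n : ℕ => max (1 - 1 / ((n : ℝ) + 1) * ‖x‖ ^ 2) 0) Filter.atTop (nhds 1) := fun x => by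
      simpa using ((u0.mul_const (‖x‖ ^ 2)).const_sub 1).max
        (tendsto_const_nhds (x := (0 : ℝ)) (f := Filter.atTop (α := ℕ)))
    have L : ∫⁻ x, ENNReal.ofReal ((1 + ε * ‖x‖ ^ 2) ^ (-s / 2) * q x) ≤
        Filter.liminf (fun n : ℕ => ∫⁻ x : Space, ENNReal.ofReal ((1 + ε * ‖x‖ ^ 2) ^ (-s / 2) *
          max (1 - 1 / ((n : ℝ) + 1) * ‖x‖ ^ 2) 0 ^ 2 * q x)) Filter.atTop := by
      have : ∀ x : Space, ENNReal.ofReal ((1 + ε * ‖x‖ ^ 2) ^ (-s / 2) * q x) =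
          Filter.liminf (fun n : ℕ => ENNReal.ofReal ((1 + ε * ‖x‖ ^ 2) ^ (-s / 2) *
            max (1 - 1 / ((n : ℝ) + 1) * ‖x‖ ^ 2) 0 ^ 2 * q x)) Filter.atTop := by
        intro x
        refine (((ENNReal.continuous_ofReal.tendsto _).comp ?_).liminf_eq).symm
        simpa using (((limM x).pow 2).const_mul ((1 + ε * ‖x‖ ^ 2) ^ (-s / 2))).mul_const (q x)
      rw [lintegral_congr this]
      refine lintegral_liminf_le fun n => (ENNReal.continuous_ofReal.comp ?_).measurable
      exact ((cω ε hε.le).mul ((mM _).pow 2)).mul hqm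
    have Er : Filter.Tendsto (fun n : ℕ => ∫⁻ x : Space, ENNReal.ofReal
        ((1 + ε * ‖x‖ ^ 2) ^ (-s / 2) * (1 / ((n : ℝ) + 1) * ‖x‖ ^ 2 *
          max (1 - 1 / ((n : ℝ) + 1) * ‖x‖ ^ 2) 0) * q x)) Filter.atTop
        (nhds (∫⁻ _ : Space, 0)) := by
      refine tendsto_lintegral_of_dominated_convergence
        (fun x : Space => ENNReal.ofReal (ε ^ (-s / 2) * ((1 + ‖x‖ ^ 2) ^ (-s / 2) * q x)))
        (fun n => ?_) (fun n => Filter.Eventually.of_forall fun x => ?_) ?_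
        (Filter.Eventually.of_forall fun x => ?_)
      · refine (ENNReal.continuous_ofReal.comp ?_).measurable
        exact ((cω ε hε.le).mul (by fun_prop)).mul hqm
      · refine ENNReal.ofReal_le_ofReal ?_
        have h1 : (1 + ε * ‖x‖ ^ 2) ^ (-s / 2) ≤ ε ^ (-s / 2) * (1 + ‖x‖ ^ 2) ^ (-s / 2) := by
          rw [← Real.mul_rpow hε.le (by positivity)]
          exact Real.rpow_le_rpow_of_nonpos (by positivity) (by linarith) (by linarith)
        have h2 : 1 / ((n : ℝ) + 1) * ‖x‖ ^ 2 * max (1 - 1 / ((n : ℝ) + 1) * ‖x‖ ^ 2) 0 ≤ 1 := by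
          have h0 : 0 ≤ 1 / ((n : ℝ) + 1) * ‖x‖ ^ 2 := by positivity
          generalize 1 / ((n : ℝ) + 1) * ‖x‖ ^ 2 = t at *
          rcases le_total (1 - t) 0 with h | h
          · rw [max_eq_right h]; simp
          · rw [max_eq_left h]; nlinarith
        calc _ ≤ (1 + ε * ‖x‖ ^ 2) ^ (-s / 2) * 1 * q x :=
              mul_le_mul_of_nonneg_right (mul_le_mul_of_nonneg_left h2 (hω0 x)) (hq0 x)
          _ ≤ ε ^ (-s / 2) * (1 + ‖x‖ ^ 2) ^ (-s / 2) * q x := by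
              rw [mul_one]; exact mul_le_mul_of_nonneg_right h1 (hq0 x)
          _ = _ := by ring
      · rw [← ofReal_integral_eq_lintegral_ofReal (hint.const_mul _)
          (Filter.Eventually.of_forall fun x => by
            have := hq0 x; simp only [Pi.zero_apply]; positivity)]
        exact ENNReal.ofReal_ne_top
      · rw [← ENNReal.ofReal_zero]
        refine (ENNReal.continuous_ofReal.tendsto _).comp ?_
        simpa using ((((u0.mul_const (‖x‖ ^ 2)).mul (limM x))).const_mul
          ((1 + ε * ‖x‖ ^ 2) ^ (-s / 2))).mul_const (q x)
    have Er' := (ENNReal.Tendsto.const_mul (a := ENNReal.ofReal (8 / (2 - s))) Er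
      (Or.inr ENNReal.ofReal_ne_top)).const_add
      (ENNReal.ofReal ((2 / (2 - s)) ^ 2) * ∫⁻ x, ENNReal.ofReal (‖x‖ ^ 2 * d x))
    rw [lintegral_zero, mul_zero, add_zero] at Er'
    refine L.trans ?_
    rw [← Er'.liminf_eq]
    exact Filter.liminf_le_liminf (Filter.Eventually.of_forall fun n =>
      hardy_cutoff hq hq0 hd hd0 hqd hs0 hs hε (by positivity))
  calc ∫⁻ x, ENNReal.ofReal (q x)
      = ∫⁻ x, Filter.liminf (fun n : ℕ => ENNReal.ofReal
          ((1 + 1 / ((n : ℝ) + 1) * ‖x‖ ^ 2) ^ (-s / 2) * q x)) Filter.atTop := by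
        refine lintegral_congr fun x => ?_
        refine (((ENNReal.continuous_ofReal.tendsto _).comp ?_).liminf_eq).symm
        have h1 : Filter.Tendsto (fun n : ℕ => 1 + 1 / ((n : ℝ) + 1) * ‖x‖ ^ 2) Filter.atTop
            (nhds 1) := by simpa using (u0.mul_const (‖x‖ ^ 2)).const_add 1
        simpa using (h1.rpow_const (p := -s / 2) (Or.inl one_ne_zero)).mul_const (q x)
    _ ≤ Filter.liminf (fun n : ℕ => ∫⁻ x, ENNReal.ofReal
          ((1 + 1 / ((n : ℝ) + 1) * ‖x‖ ^ 2) ^ (-s / 2) * q x)) Filter.atTop :=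
        lintegral_liminf_le fun n => by
          refine (ENNReal.continuous_ofReal.comp ?_).measurable
          exact (cω (1 / ((n : ℝ) + 1)) (by positivity)).mul hqm
    _ ≤ _ := by
        refine Filter.liminf_le_of_frequently_le' (Filter.Frequently.of_forall fun n => ?_)
        refine step _ (by positivity) ?_
        rw [div_le_one (by positivity)]
        linarith [(Nat.cast_nonneg n : (0 : ℝ) ≤ n)]

/-- Integrability of `⟨x⟩^{-s} |f|²` with `s = 2 (p-1) / (p+1)`, by Young's inequality. -/
theorem integrable_weighted_sq {p : ℝ} (hp : 1 < p) {f : Space → ℂ} (hf : Continuous f)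
    (hfin : ∫⁻ x, ENNReal.ofReal ((1 + ‖x‖ ^ 2) * ‖f x‖ ^ (p + 1)) < ∞) :
    Integrable fun x : Space => (1 + ‖x‖ ^ 2) ^ (-(2 * (p - 1) / (p + 1)) / 2) * ‖f x‖ ^ 2 := by
  have hp1 : 0 < p + 1 := by linarith
  have hp2 : 0 < p - 1 := by linarith
  have c1 : Continuous fun x : Space => (1 + ‖x‖ ^ 2) * ‖f x‖ ^ (p + 1) :=
    (by fun_prop : Continuous fun x : Space => 1 + ‖x‖ ^ 2).mul
      (hf.norm.rpow_const fun x => Or.inr hp1.le)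
  have i1 : Integrable fun x : Space => (1 + ‖x‖ ^ 2) * ‖f x‖ ^ (p + 1) := by
    refine ⟨c1.aestronglyMeasurable, ?_⟩
    rw [hasFiniteIntegral_iff_ofReal (Filter.Eventually.of_forall fun x => by positivity)]
    exact hfin
  have i2 : Integrable fun x : Space => (1 + ‖x‖ ^ 2) ^ (-(2 * (p + 1) / (p - 1)) / 2) := by
    refine integrable_rpow_neg_one_add_norm_sq ?_
    rw [finrank_euclideanSpace_fin, lt_div_iff₀ hp2]
    push_cast; linarith
  refine (i1.add i2).mono' ?_ (Filter.Eventually.of_forall fun x => ?_)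
  · refine Continuous.aestronglyMeasurable (Continuous.mul ?_ (by fun_prop))
    exact Continuous.rpow_const (by fun_prop) fun x => Or.inl (by positivity)
  · set B := 1 + ‖x‖ ^ 2
    have hB : 0 < B := by positivity
    have hx := norm_nonneg (f x)
    rw [Real.norm_of_nonneg (by positivity)]
    have hpq : ((p + 1) / 2).HolderConjugate ((p + 1) / (p - 1)) := by
      refine Real.holderConjugate_iff.2 ⟨by linarith, ?_⟩
      rw [inv_div, inv_div, ← add_div]
      field_simp; ring
    have y := Real.young_inequality_of_nonneg (a := ‖f x‖ ^ (2 : ℝ) * B ^ (2 / (p + 1)))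
      (b := B ^ (-1 : ℝ)) (by positivity) (by positivity) hpq
    have e1 : (‖f x‖ ^ (2 : ℝ) * B ^ (2 / (p + 1))) ^ ((p + 1) / 2) = B * ‖f x‖ ^ (p + 1) := by
      rw [Real.mul_rpow (by positivity) (by positivity), ← Real.rpow_mul hx,
        ← Real.rpow_mul hB.le]
      rw [show 2 / (p + 1) * ((p + 1) / 2) = 1 by field_simp,
        show 2 * ((p + 1) / 2) = p + 1 by ring, Real.rpow_one, mul_comm]
    have e2 : (B ^ (-1 : ℝ)) ^ ((p + 1) / (p - 1)) = B ^ (-(2 * (p + 1) / (p - 1)) / 2) := by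
      rw [← Real.rpow_mul hB.le]; congr 1; ring
    have e3 : ‖f x‖ ^ (2 : ℝ) * B ^ (2 / (p + 1)) * B ^ (-1 : ℝ) =
        B ^ (-(2 * (p - 1) / (p + 1)) / 2) * ‖f x‖ ^ 2 := by
      rw [mul_assoc, ← Real.rpow_add hB, Real.rpow_two, mul_comm]
      congr 2
      field_simp; ring
    rw [e1, e2, e3] at y
    refine y.trans (add_le_add (div_le_self (by positivity) ?_) (div_le_self (by positivity) ?_))
    · linarith
    · rw [le_div_iff₀ hp2]; linarith

/-! ### The initial energy -/

theorem continuous_event (t : ℝ) : Continuous (event t) := by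
  refine continuous_pi fun i => ?_
  unfold event
  fin_cases i <;> simp <;> fun_prop

theorem lintegral_event (t : ℝ) {F : Spacetime → ℝ} (hF : Continuous F) :
    ∫⁻ x : Space, ENNReal.ofReal (F (event t x)) =
      ∫⁻ y : Fin 2 → ℝ, ENNReal.ofReal (F ![t, y 0, y 1]) := by
  have ev : Continuous fun y : Fin 2 → ℝ => (![t, y 0, y 1] : Spacetime) := by
    refine continuous_pi fun i => ?_
    fin_cases i <;> simp <;> fun_prop
  exact (PiLp.volume_preserving_ofLp (Fin 2)).lintegral_comp
    (f := fun y : Fin 2 → ℝ => ENNReal.ofReal (F ![t, y 0, y 1]))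
    (ENNReal.continuous_ofReal.comp (hF.comp ev)).measurable

theorem fderiv_initial (hs : IsSolution p φ₀ φ₁ φ A) (x v : Space) :
    DifferentiableAt ℝ φ₀ x ∧
      fderiv ℝ φ₀ x v = fderiv ℝ φ (event 0 x) (event 0 v) := by
  obtain ⟨L, hL⟩ : ∃ L : Space →L[ℝ] Spacetime, ∀ x, L x = event 0 x :=
    ⟨LinearMap.toContinuousLinearMap
      { toFun := event 0
        map_add' := fun x y => by ext i; fin_cases i <;> simp [event]
        map_smul' := fun c x => by ext i; fin_cases i <;> simp [event] }, fun x => rfl⟩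
  have hev : HasFDerivAt (event 0) L x := by
    have := L.hasFDerivAt (x := x)
    rwa [show ⇑L = event 0 from funext hL] at this
  have e : φ₀ = φ ∘ event 0 := funext fun x => (hs.initial_field x).symm
  have h := ((hs.contDiff_field.differentiable two_ne_zero (event 0 x)).hasFDerivAt).comp x hev
  rw [← e] at h
  refine ⟨h.differentiableAt, ?_⟩
  rw [h.fderiv, ContinuousLinearMap.comp_apply, hL]

theorem contDiff_initial (hs : IsSolution p φ₀ φ₁ φ A) : ContDiff ℝ 1 φ₀ := by
  have e : φ₀ = fun x => φ (event 0 x) := funext fun x => (hs.initial_field x).symm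
  rw [e]
  refine (hs.contDiff_field.of_le (by norm_num)).comp (contDiff_pi.2 fun i => ?_)
  unfold event
  fin_cases i <;> simp <;> fun_prop

theorem spaceCovD_initial (hs : IsSolution p φ₀ φ₁ φ A) (j : Fin 2) (x : Space) :
    spaceCovD (initialConnection A) j φ₀ x = covD A j.succ φ (event 0 x) := by
  unfold spaceCovD initialConnection covD pd
  rw [(fderiv_initial hs x _).2, ← hs.initial_field]
  congr 2
  fin_cases j <;> · ext i; fin_cases i <;> simp [event]

theorem rdot_self (a : ℂ) : rdot a a = ‖a‖ ^ 2 := by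
  rw [Complex.sq_norm, Complex.normSq_apply]; rfl

/-- Diamagnetic Cauchy–Schwarz inequality for the radial derivative of `|φ₀|²`. -/
theorem fderiv_norm_sq_initial (hs : IsSolution p φ₀ φ₁ φ A) (x : Space) :
    fderiv ℝ (fun x => ‖φ₀ x‖ ^ 2) x x ^ 2 ≤ 4 * ‖φ₀ x‖ ^ 2 *
      (‖x‖ ^ 2 * ∑ j, ‖spaceCovD (initialConnection A) j φ₀ x‖ ^ 2) := by
  have hd := (contDiff_initial hs).differentiable one_ne_zero x
  rw [← sum_apply_mul_fderiv]
  have h : ∀ j : Fin 2, fderiv ℝ (fun x => ‖φ₀ x‖ ^ 2) x (EuclideanSpace.single j 1) =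
      2 * rdot (φ₀ x) (spaceCovD (initialConnection A) j φ₀ x) := by
    intro j
    have := hd.hasFDerivAt.norm_sq
    rw [this.fderiv]
    simp [rdot, spaceCovD, Complex.inner]
    ring
  simp only [h, Fin.sum_univ_two, EuclideanSpace.norm_sq_eq, Real.norm_eq_abs, sq_abs]
  rw [← rdot_self, ← rdot_self, ← rdot_self]
  generalize spaceCovD (initialConnection A) 0 φ₀ x = a
  generalize spaceCovD (initialConnection A) 1 φ₀ x = b
  generalize φ₀ x = f
  generalize x.ofLp 0 = s
  generalize x.ofLp 1 = t
  -- Lagrange's identity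
  have h1 : (s * (2 * rdot f a) + t * (2 * rdot f b)) ^ 2 +
      4 * ((f.re * (s * a.im + t * b.im) - f.im * (s * a.re + t * b.re)) ^ 2 +
        rdot f f * ((s * b.re - t * a.re) ^ 2 + (s * b.im - t * a.im) ^ 2)) =
      4 * rdot f f * ((s ^ 2 + t ^ 2) * (rdot a a + rdot b b)) := by
    unfold rdot; ring
  have h2 : 0 ≤ rdot f f * ((s * b.re - t * a.re) ^ 2 + (s * b.im - t * a.im) ^ 2) :=
    mul_nonneg (rdot_self_nonneg f) (by positivity)
  nlinarith [sq_nonneg (f.re * (s * a.im + t * b.im) - f.im * (s * a.re + t * b.re))]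

/-- The conformal energy controls the mass of `φ₀`. -/
theorem lintegral_norm_sq_initial_le (hp : 1 < p) (hs : IsSolution p φ₀ φ₁ φ A)
    (hE : conformalEnergy p (initialConnection A) φ₀ φ₁ < ∞) :
    ∫⁻ x, ENNReal.ofReal (‖φ₀ x‖ ^ 2) ≤
      ENNReal.ofReal (((p + 1) / 2) ^ 2) * conformalEnergy p (initialConnection A) φ₀ φ₁ := by
  have hp1 : 0 < p + 1 := by linarith
  have c0 := contDiff_initial hs
  have hfin : ∫⁻ x, ENNReal.ofReal ((1 + ‖x‖ ^ 2) * ‖φ₀ x‖ ^ (p + 1)) < ∞ := by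
    refine lt_of_le_of_lt (lintegral_mono fun x => ENNReal.ofReal_le_ofReal ?_) hE
    have h1 : 1 + ‖x‖ ^ 2 ≤ (1 + ‖x‖) ^ 2 := by nlinarith [norm_nonneg x]
    have h2 := mul_le_mul_of_nonneg_right h1 (Real.rpow_nonneg (norm_nonneg (φ₀ x)) (p + 1))
    have h3 : 0 ≤ (1 + ‖x‖) ^ 2 * ((∑ j, ‖spaceCovD (initialConnection A) j φ₀ x‖ ^ 2) +
        ‖φ₁ x‖ ^ 2) := by positivity
    linarith
  have cd : Continuous fun x => ∑ j, ‖spaceCovD (initialConnection A) j φ₀ x‖ ^ 2 := by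
    simp only [spaceCovD_initial hs]
    refine continuous_finsetSum _ fun j _ => ?_
    exact (((contDiff_covD hs.contDiff_field hs.contDiff_connection _).continuous.comp
      (continuous_event 0)).norm.pow 2)
  have h := hardy (q := fun x => ‖φ₀ x‖ ^ 2) (c0.norm_sq ℝ) (fun x => by positivity) cd
    (fun x => by positivity) (fderiv_norm_sq_initial hs) (s := 2 * (p - 1) / (p + 1))
    (div_nonneg (by linarith) hp1.le) (by rw [div_lt_iff₀ hp1]; linarith)
    (integrable_weighted_sq hp c0.continuous hfin)
  have e : 2 / (2 - 2 * (p - 1) / (p + 1)) = (p + 1) / 2 := by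
    have : 2 - 2 * (p - 1) / (p + 1) = 4 / (p + 1) := by field_simp; ring
    rw [this]; field_simp; norm_num
  rw [e] at h
  refine h.trans (mul_le_mul' le_rfl (lintegral_mono fun x => ENNReal.ofReal_le_ofReal ?_))
  have h1 : ‖x‖ ^ 2 ≤ (1 + ‖x‖) ^ 2 := by nlinarith [norm_nonneg x]
  have h2 : 0 ≤ ∑ j, ‖spaceCovD (initialConnection A) j φ₀ x‖ ^ 2 := by positivity
  have h3 := mul_le_mul_of_nonneg_right h1 h2
  have h4 : 0 ≤ (1 + ‖x‖) ^ 2 * ‖φ₁ x‖ ^ 2 + (1 + ‖x‖) ^ 2 * ‖φ₀ x‖ ^ (p + 1) := by positivity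
  linarith

/-- Upper bound of the algebraic energy density; `φ` enters only through `f σ² ≤ 1/4`. -/
theorem stress_upper_bound {u y h δ κ σ V r : ℝ} (hh : 0 ≤ h) (hh1 : h ≤ 1) (hδ : 0 ≤ δ)
    (hV : 0 ≤ V) (hκ : 1 ≤ κ) (hf : u ^ 2 * h + δ ≤ κ * (1 + u ^ 2)) (hr : u ^ 2 + y ^ 2 ≤ r ^ 2)
    (hσ : (u ^ 2 * h + δ) * σ ^ 2 ≤ 1 / 4) (a₀ φ b c : ℂ) :
    stressU (u ^ 2 * h + δ) (y * u * h) (y ^ 2 * h) V (a₀ + (σ : ℂ) * φ) c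
      + stressV (u ^ 2 * h + δ) (y * u * h) (y ^ 2 * h) V b c ≤
      κ * (1 + r ^ 2) * (4 * rdot a₀ a₀ + 2 * rdot b b + 2 * rdot c c + 2 * V) + rdot φ φ := by
  set f := u ^ 2 * h + δ with hfdef
  set B := κ * (1 + r ^ 2) with hB
  set a := a₀ + (σ : ℂ) * φ with ha
  have h0 := fun a : ℝ => sq_nonneg a
  have hf0 : 0 ≤ f := by positivity
  have hfB : f ≤ B := hf.trans (mul_le_mul_of_nonneg_left (by nlinarith [h0 y]) (by linarith))
  have hrB : r ^ 2 ≤ B := by nlinarith [h0 r]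
  have hyh : y ^ 2 * h ≤ B := by nlinarith [h0 y, h0 u]
  have huh : u ^ 2 * h ≤ f := by linarith
  -- Cauchy–Schwarz on the mixed terms
  have s1 : y * u * h * rdot a c ≤ u ^ 2 * h * rdot a a + y ^ 2 * h * (rdot c c / 4) := by
    have h1 := mul_nonneg hh (h0 (u * a.re - y / 2 * c.re))
    have h2 := mul_nonneg hh (h0 (u * a.im - y / 2 * c.im))
    unfold rdot; linarith
  have s2 : y * u * h * rdot c b ≤ u ^ 2 * h * (rdot c c / 4) + y ^ 2 * h * rdot b b := by
    have h1 := mul_nonneg hh (h0 (u / 2 * c.re - y * b.re))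
    have h2 := mul_nonneg hh (h0 (u / 2 * c.im - y * b.im))
    unfold rdot; linarith
  have s3 : rdot a a ≤ 2 * rdot a₀ a₀ + 2 * (σ ^ 2 * rdot φ φ) := by
    have h1 := h0 (a₀.re - σ * φ.re)
    have h2 := h0 (a₀.im - σ * φ.im)
    simp only [ha, rdot, Complex.add_re, Complex.add_im, Complex.mul_re, Complex.mul_im,
      Complex.ofReal_re, Complex.ofReal_im]
    linarith
  have nφ := rdot_self_nonneg φ
  have na := rdot_self_nonneg a
  have na₀ := rdot_self_nonneg a₀
  have nb := rdot_self_nonneg b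
  have nc := rdot_self_nonneg c
  have t1 := mul_le_mul_of_nonneg_right huh na
  have t2 := mul_le_mul_of_nonneg_left s3 hf0
  have t3 := mul_le_mul_of_nonneg_right hσ nφ
  have t4 := mul_le_mul_of_nonneg_right hfB na₀
  have t5 := mul_le_mul_of_nonneg_right hyh nb
  have t6 := mul_le_mul_of_nonneg_right hyh nc
  have t7 := mul_le_mul_of_nonneg_right hfB nc
  have t8 := mul_le_mul_of_nonneg_right huh nc
  have t9 := mul_le_mul_of_nonneg_right hfB hV
  have t10 := mul_le_mul_of_nonneg_right hyh hV
  have hB0 : 0 ≤ B := hf0.trans hfB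
  have t11 := mul_nonneg hB0 nc
  unfold stressU stressV
  linarith

/-- The bound `f σ² ≤ 1/4`, which makes the zeroth order part of the initial energy at most the
mass of `φ₀`. -/
theorem weightF_mul_shift_sq (hβ : 0 ≤ β) (hκ : 1 ≤ κ) (u : ℝ) :
    weightF β κ u * shift β κ u ^ 2 ≤ 1 / 4 := by
  have hf := weightF_pos hκ β u
  have h1 := weightF_ge hκ β u
  have h2 := weightH_le_one hβ u
  have h3 := weightH_pos β u
  have e : weightF β κ u * shift β κ u ^ 2 = (u * weightH β u) ^ 2 / (4 * weightF β κ u) := by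
    unfold shift; field_simp; norm_num
  rw [e, div_le_iff₀ (by positivity)]
  nlinarith [mul_nonneg (mul_nonneg (sq_nonneg u) h3.le) (sub_nonneg.2 h2)]

theorem initial_energyDensity_le (hp : 1 < p) (hβ : 0 ≤ β) (hκ : 1 ≤ κ) (he : e ^ 2 = 1)
    (hs : IsSolution p φ₀ φ₁ φ A) (x : Space) :
    energyDensity p β κ e φ A (event 0 x) ≤
      4 * κ * ((1 + ‖x‖) ^ 2 * ((∑ j, ‖spaceCovD (initialConnection A) j φ₀ x‖ ^ 2) + ‖φ₁ x‖ ^ 2)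
        + (1 + ‖x‖) ^ 2 * ‖φ₀ x‖ ^ (p + 1)) + ‖φ₀ x‖ ^ 2 := by
  have hp1 : 0 < p + 1 := by linarith
  have hx := norm_nonneg x
  have hx2 : ‖x‖ ^ 2 = x 0 ^ 2 + x 1 ^ 2 := by
    simp [EuclideanSpace.norm_sq_eq, Fin.sum_univ_two]
  have eu : optical e (event 0 x) ^ 2 = x 0 ^ 2 := by
    simp only [optical, event, Matrix.cons_val_zero, Matrix.cons_val_one]
    linear_combination (x 0 ^ 2) * he
  have hh := weightH_pos β (optical e (event 0 x))
  have key := stress_upper_bound (u := optical e (event 0 x)) (y := x 1) (r := ‖x‖) (κ := κ)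
    (σ := shift β κ (optical e (event 0 x)))
    (δ := weightH β (optical e (event 0 x)) + (κ - 1) * min (optical e (event 0 x)) 0 ^ 2)
    hh.le (weightH_le_one hβ _)
    (add_nonneg hh.le (mul_nonneg (sub_nonneg.2 hκ) (sq_nonneg _)))
    (potential_nonneg (φ := φ) hp (event 0 x)) hκ
    (by rw [← weightF_eq_add]; exact weightF_le hβ hκ _) (by rw [eu, hx2])
    (by rw [← weightF_eq_add]; exact weightF_mul_shift_sq hβ hκ _)
    (covDir A (frameU e) φ (event 0 x)) (φ (event 0 x)) (covDir A (frameV e) φ (event 0 x))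
    (covDir A frameY φ (event 0 x))
  rw [← weightF_eq_add] at key
  have key' : energyDensity p β κ e φ A (event 0 x) ≤ _ := key
  refine key'.trans ?_
  rw [Fin.sum_univ_two, spaceCovD_initial hs, spaceCovD_initial hs, ← hs.initial_velocity,
    ← hs.initial_field, covDir_frameU, covDir_frameV, covDir_frameY]
  change _ ≤ 4 * κ * ((1 + ‖x‖) ^ 2 * (‖covD A 1 φ (event 0 x)‖ ^ 2 +
    ‖covD A 2 φ (event 0 x)‖ ^ 2 + ‖covD A 0 φ (event 0 x)‖ ^ 2)
        + (1 + ‖x‖) ^ 2 * ‖φ (event 0 x)‖ ^ (p + 1)) + ‖φ (event 0 x)‖ ^ 2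
  have hW : 0 ≤ ‖φ (event 0 x)‖ ^ (p + 1) := by positivity
  have hV : potential p φ (event 0 x) ≤ ‖φ (event 0 x)‖ ^ (p + 1) := by
    unfold potential
    exact div_le_self hW (by linarith)
  simp only [← rdot_self]
  generalize covD A 0 φ (event 0 x) = d0
  generalize covD A 1 φ (event 0 x) = d1
  generalize covD A 2 φ (event 0 x) = d2
  generalize ‖φ (event 0 x)‖ ^ (p + 1) = w at *
  generalize potential p φ (event 0 x) = v at *
  have n0 := rdot_self_nonneg d0
  have n1 := rdot_self_nonneg d1
  have n2 := rdot_self_nonneg d2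
  have a1 : 4 * rdot (((1 / 2 : ℝ) : ℂ) * d0 - ((e / 2 : ℝ) : ℂ) * d1)
      (((1 / 2 : ℝ) : ℂ) * d0 - ((e / 2 : ℝ) : ℂ) * d1) ≤ 2 * rdot d0 d0 + 2 * rdot d1 d1 := by
    have h1 := sq_nonneg (d0.re + e * d1.re)
    have h2 := sq_nonneg (d0.im + e * d1.im)
    simp only [rdot, Complex.sub_re, Complex.sub_im, Complex.mul_re, Complex.mul_im,
      Complex.ofReal_re, Complex.ofReal_im]
    have h3 : e ^ 2 * (d1.re ^ 2 + d1.im ^ 2) = d1.re ^ 2 + d1.im ^ 2 := by rw [he, one_mul]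
    linarith
  have a2 : 2 * rdot (((1 / 2 : ℝ) : ℂ) * d0 + ((e / 2 : ℝ) : ℂ) * d1)
      (((1 / 2 : ℝ) : ℂ) * d0 + ((e / 2 : ℝ) : ℂ) * d1) ≤ rdot d0 d0 + rdot d1 d1 := by
    have h1 := sq_nonneg (d0.re - e * d1.re)
    have h2 := sq_nonneg (d0.im - e * d1.im)
    simp only [rdot, Complex.add_re, Complex.add_im, Complex.mul_re, Complex.mul_im,
      Complex.ofReal_re, Complex.ofReal_im]
    have h3 : e ^ 2 * (d1.re ^ 2 + d1.im ^ 2) = d1.re ^ 2 + d1.im ^ 2 := by rw [he, one_mul]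
    linarith
  have b1 : κ * (1 + ‖x‖ ^ 2) ≤ κ * (1 + ‖x‖) ^ 2 :=
    mul_le_mul_of_nonneg_left (by nlinarith) (by linarith)
  have b0 : 0 ≤ κ * (1 + ‖x‖ ^ 2) := by positivity
  have b2 := mul_le_mul_of_nonneg_left (a := κ * (1 + ‖x‖ ^ 2))
    (by linarith : _ ≤ 4 * (rdot d1 d1 + rdot d2 d2 + rdot d0 d0 + w))
    b0 (b := 4 * rdot (((1 / 2 : ℝ) : ℂ) * d0 - ((e / 2 : ℝ) : ℂ) * d1)
      (((1 / 2 : ℝ) : ℂ) * d0 - ((e / 2 : ℝ) : ℂ) * d1) +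
      2 * rdot (((1 / 2 : ℝ) : ℂ) * d0 + ((e / 2 : ℝ) : ℂ) * d1)
      (((1 / 2 : ℝ) : ℂ) * d0 + ((e / 2 : ℝ) : ℂ) * d1) + 2 * rdot d2 d2 + 2 * v)
  have b3 := mul_le_mul_of_nonneg_right b1
    (by linarith : 0 ≤ 4 * (rdot d1 d1 + rdot d2 d2 + rdot d0 d0 + w))
  linarith

/-- The initial energy of the multiplier is controlled by the conformal energy. -/
theorem lintegral_initial_energyDensity_le (hp : 1 < p) (hβ : 0 ≤ β) (hκ : 1 ≤ κ) (he : e ^ 2 = 1)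
    (hs : IsSolution p φ₀ φ₁ φ A)
    (hE : conformalEnergy p (initialConnection A) φ₀ φ₁ < ∞) :
    ∫⁻ x, ENNReal.ofReal (energyDensity p β κ e φ A (event 0 x)) ≤
      ENNReal.ofReal (4 * κ + ((p + 1) / 2) ^ 2) *
        conformalEnergy p (initialConnection A) φ₀ φ₁ := by
  have hκ0 : 0 ≤ 4 * κ := by linarith
  have m : Measurable fun x => ENNReal.ofReal (‖φ₀ x‖ ^ 2) :=
    (ENNReal.continuous_ofReal.comp ((contDiff_initial hs).continuous.norm.pow 2)).measurable
  rw [ENNReal.ofReal_add hκ0 (by positivity), add_mul]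
  refine le_trans ?_ (add_le_add le_rfl (lintegral_norm_sq_initial_le hp hs hE))
  rw [conformalEnergy, ← lintegral_const_mul' _ _ ENNReal.ofReal_ne_top, ← lintegral_add_right _ m]
  refine lintegral_mono fun x => ?_
  rw [← ENNReal.ofReal_mul hκ0, ← ENNReal.ofReal_add (by positivity) (by positivity)]
  exact ENNReal.ofReal_le_ofReal (initial_energyDensity_le hp hβ hκ he hs x)

/-! ### Coercivity -/

/-- On the half plane where `e x₁ ≤ 0`, the energy density controls the potential energy with the
full weight. -/
theorem weighted_potential_le (hp : 1 < p) {α : ℝ} (hα0 : 0 ≤ α) (hα : α ≤ 2) (hκ : 1 ≤ κ)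
    (he : e ^ 2 = 1) {t : ℝ} (ht : 0 ≤ t) {x : Space} (hx : e * x 0 ≤ 0) :
    ‖φ (event t x)‖ ^ (p + 1) * (1 + t + ‖x‖) ^ α ≤
      6 * (p + 1) * energyDensity p (2 - α) κ e φ A (event t x) := by
  have hp1 : 0 < p + 1 := by linarith
  have hn := norm_nonneg x
  have hx2 : ‖x‖ ^ 2 = x 0 ^ 2 + x 1 ^ 2 := by
    simp [EuclideanSpace.norm_sq_eq, Fin.sum_univ_two]
  set u := optical e (event t x) with hu
  have hu' : u = t - e * x 0 := by simp [hu, optical, event]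
  have hu0 : 0 ≤ u := by linarith
  have hh := weightH_pos (2 - α) u
  set V := potential p φ (event t x)
  have hV : 0 ≤ V := potential_nonneg hp _
  have low := stress_lower_bound (u := u) (y := x 1) (V := V) hh.le
    (add_nonneg hh.le (mul_nonneg (sub_nonneg.2 hκ) (sq_nonneg (min u 0))))
    (modDerivU (2 - α) κ e φ A (event t x)) (covDir A (frameV e) φ (event t x))
    (covDir A frameY φ (event t x))
  rw [← weightF_eq_add] at low
  have low' : _ ≤ energyDensity p (2 - α) κ e φ A (event t x) := low
  set Q := 1 + u ^ 2 + x 1 ^ 2 with hQ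
  have hQ0 : 0 < Q := by positivity
  have hQh : Q ^ (α / 2) ≤ weightH (2 - α) u * Q := by
    have h1 : weightH (2 - α) u = (1 + u ^ 2) ^ (α / 2 - 1) := by
      unfold weightH; rw [max_eq_left hu0]; congr 1; ring
    have h2 : Q ^ (α / 2 - 1) ≤ (1 + u ^ 2) ^ (α / 2 - 1) :=
      Real.rpow_le_rpow_of_nonpos (by positivity) (by nlinarith [sq_nonneg (x 1)]) (by linarith)
    calc Q ^ (α / 2) = Q ^ (α / 2 - 1) * Q := by
          rw [← Real.rpow_add_one hQ0.ne']; congr 1; ring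
      _ ≤ _ := by rw [h1]; exact mul_le_mul_of_nonneg_right h2 hQ0.le
  -- `1 + u² + y² ≥ 1 + t² + |x|² ≥ (1 + t + |x|)² / 3`
  have hQ3 : (1 + t + ‖x‖) ^ 2 ≤ 3 * Q := by
    have h1 : 1 + t ^ 2 + ‖x‖ ^ 2 ≤ Q := by
      rw [hQ, hu', hx2]
      have h3 : (e * x 0) ^ 2 = x 0 ^ 2 := by rw [mul_pow, he, one_mul]
      nlinarith [mul_nonneg ht (neg_nonneg.2 hx)]
    nlinarith [sq_nonneg (1 - t), sq_nonneg (1 - ‖x‖), sq_nonneg (t - ‖x‖)]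
  have hpow : (1 + t + ‖x‖) ^ α ≤ 3 * Q ^ (α / 2) := by
    calc (1 + t + ‖x‖) ^ α = ((1 + t + ‖x‖) ^ 2) ^ (α / 2) := by
          rw [← Real.rpow_natCast, ← Real.rpow_mul (by positivity)]; congr 1; push_cast; ring
      _ ≤ (3 * Q) ^ (α / 2) := Real.rpow_le_rpow (by positivity) hQ3 (by linarith)
      _ = 3 ^ (α / 2) * Q ^ (α / 2) := Real.mul_rpow (by norm_num) hQ0.le
      _ ≤ 3 * Q ^ (α / 2) := by
          refine mul_le_mul_of_nonneg_right ?_ (by positivity)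
          calc (3 : ℝ) ^ (α / 2) ≤ 3 ^ (1 : ℝ) :=
                Real.rpow_le_rpow_of_exponent_le (by norm_num) (by linarith)
            _ = 3 := Real.rpow_one 3
  have eV : ‖φ (event t x)‖ ^ (p + 1) = 2 * (p + 1) * V := by
    simp only [V, potential]; field_simp
  have c1 : V * Q ^ (α / 2) ≤ energyDensity p (2 - α) κ e φ A (event t x) := by
    refine le_trans (mul_le_mul_of_nonneg_left (hQh.trans ?_) hV) low'
    rw [hQ]
    nlinarith [mul_nonneg (sub_nonneg.2 hκ) (sq_nonneg (min u 0))]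
  rw [eV]
  calc 2 * (p + 1) * V * (1 + t + ‖x‖) ^ α ≤ 2 * (p + 1) * V * (3 * Q ^ (α / 2)) :=
        mul_le_mul_of_nonneg_left hpow (by positivity)
    _ = 6 * (p + 1) * (V * Q ^ (α / 2)) := by ring
    _ ≤ _ := mul_le_mul_of_nonneg_left c1 (by positivity)

/-- The weighted estimate with its constant: the energies of the multipliers for `e = 1` and
`e = -1` are added, each covering one half plane. -/
theorem weighted_decay (hp : 1 < p) (hs : IsSolution p φ₀ φ₁ φ A)
    (hE : conformalEnergy p (initialConnection A) φ₀ φ₁ < ∞) {t : ℝ} (ht : 0 ≤ t) :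
    ∫⁻ x : Space, ENNReal.ofReal
        (‖φ (event t x)‖ ^ (p + 1) * (1 + t + ‖x‖) ^ min ((p - 1) / 2) 2) ≤
      ENNReal.ofReal (12 * (p + 1) * (4 * max 1 ((p - 1) / 4) + ((p + 1) / 2) ^ 2)) *
        conformalEnergy p (initialConnection A) φ₀ φ₁ := by
  set α := min ((p - 1) / 2) 2 with hα
  set κ := max 1 ((p - 1) / 4) with hκdef
  have hα2 : α ≤ 2 := min_le_right _ _
  have hαp : α ≤ (p - 1) / 2 := min_le_left _ _
  have hα0 : 0 ≤ α := le_min (by linarith) (by norm_num)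
  have hκ : 1 ≤ κ := le_max_left _ _
  have hκ' : (p - 1) / 4 ≤ κ := le_max_right _ _
  have hp1 : 0 ≤ 6 * (p + 1) := by linarith
  have en : ∀ e : ℝ, e ^ 2 = 1 →
      ∫⁻ x, ENNReal.ofReal (energyDensity p (2 - α) κ e φ A (event t x)) ≤
        ENNReal.ofReal (4 * κ + ((p + 1) / 2) ^ 2) *
          conformalEnergy p (initialConnection A) φ₀ φ₁ := by
    intro e he
    have cE := (contDiff_energyDensity (β := 2 - α) (e := e) hp hs hκ).continuous
    have hβ : 0 ≤ 2 - α := by linarith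
    rw [lintegral_event t cE]
    refine (energy_le hp hβ (by linarith) hκ hκ' he hs ht).trans ?_
    rw [← lintegral_event 0 cE]
    exact lintegral_initial_energyDensity_le hp hβ hκ he hs hE
  have nn : ∀ (e : ℝ) (z : Spacetime), 0 ≤ energyDensity p (2 - α) κ e φ A z := fun e z =>
    energyDensity_nonneg hp hκ z
  have pt : ∀ x : Space, ENNReal.ofReal (‖φ (event t x)‖ ^ (p + 1) * (1 + t + ‖x‖) ^ α) ≤
      ENNReal.ofReal (6 * (p + 1)) *
        (ENNReal.ofReal (energyDensity p (2 - α) κ 1 φ A (event t x)) +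
          ENNReal.ofReal (energyDensity p (2 - α) κ (-1) φ A (event t x))) := by
    intro x
    rw [← ENNReal.ofReal_add (nn _ _) (nn _ _), ← ENNReal.ofReal_mul hp1]
    refine ENNReal.ofReal_le_ofReal ?_
    rcases le_total (x 0) 0 with h | h
    · have := weighted_potential_le (φ := φ) (A := A) (e := 1) hp hα0 hα2 hκ (by norm_num) ht
        (x := x) (by linarith)
      have := mul_nonneg hp1 (nn (-1) (event t x))
      linarith
    · have := weighted_potential_le (φ := φ) (A := A) (e := -1) hp hα0 hα2 hκ (by norm_num) ht
        (x := x) (by linarith)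
      have := mul_nonneg hp1 (nn 1 (event t x))
      linarith
  refine (lintegral_mono pt).trans ?_
  have m : Measurable fun x => ENNReal.ofReal (energyDensity p (2 - α) κ 1 φ A (event t x)) :=
    (ENNReal.continuous_ofReal.comp
      ((contDiff_energyDensity hp hs hκ).continuous.comp (continuous_event t))).measurable
  rw [lintegral_const_mul' _ _ ENNReal.ofReal_ne_top, lintegral_add_left m]
  refine (mul_le_mul' le_rfl (add_le_add (en 1 (by norm_num)) (en (-1) (by norm_num)))).trans_eq ?_
  rw [← two_mul, ← mul_assoc, ← mul_assoc, ← ENNReal.ofReal_ofNat 2, ← ENNReal.ofReal_mul hp1,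
    ← ENNReal.ofReal_mul (by linarith)]
  congr 2
  ring

end ChernSimonsHiggs

theorem theorem1p1 (p : ℝ) (hp : 1 < p) :
    ∃ C : ℝ, 0 < C ∧
      ∀ (φ₀ φ₁ : ChernSimonsHiggs.Space → ℂ) (φ : ChernSimonsHiggs.Spacetime → ℂ)
        (A : Fin 3 → ChernSimonsHiggs.Spacetime → ℝ),
        ChernSimonsHiggs.IsSolution p φ₀ φ₁ φ A →
        ChernSimonsHiggs.conformalEnergy p (ChernSimonsHiggs.initialConnection A) φ₀ φ₁ < ∞ →
        ∀ t : ℝ, 0 ≤ t →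
          (∫⁻ x : ChernSimonsHiggs.Space, ENNReal.ofReal
              (‖φ (ChernSimonsHiggs.event t x)‖ ^ (p + 1)
                * (1 + t + ‖x‖) ^ min ((p - 1) / 2) 2)
            ≤ ENNReal.ofReal C * ChernSimonsHiggs.conformalEnergy p
                (ChernSimonsHiggs.initialConnection A) φ₀ φ₁) ∧
          (∫⁻ x : ChernSimonsHiggs.Space, ENNReal.ofReal
              (‖φ (ChernSimonsHiggs.event t x)‖ ^ (p + 1))
            ≤ ENNReal.ofReal (C * (1 + t) ^ (-min ((p - 1) / 2) 2))
                * ChernSimonsHiggs.conformalEnergy p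
                    (ChernSimonsHiggs.initialConnection A) φ₀ φ₁) := by
  have hp1 : 0 < p + 1 := by linarith
  have hC : 0 < 12 * (p + 1) * (4 * max 1 ((p - 1) / 4) + ((p + 1) / 2) ^ 2) := by
    have := le_max_left 1 ((p - 1) / 4)
    positivity
  refine ⟨_, hC, fun φ₀ φ₁ φ A hs hE t ht => ?_⟩
  have h := ChernSimonsHiggs.weighted_decay hp hs hE ht
  refine ⟨h, ?_⟩
  have h1t : 0 < 1 + t := by linarith
  set α := min ((p - 1) / 2) 2 with hα
  have hα0 : 0 ≤ α := le_min (by linarith) (by norm_num)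
  rw [mul_comm (12 * (p + 1) * _), ENNReal.ofReal_mul (by positivity), mul_assoc]
  refine le_trans ?_ (mul_le_mul' le_rfl h)
  rw [← lintegral_const_mul' _ _ ENNReal.ofReal_ne_top]
  refine lintegral_mono fun x => ?_
  rw [← ENNReal.ofReal_mul (by positivity)]
  refine ENNReal.ofReal_le_ofReal ?_
  have h1 : (1 + t) ^ α ≤ (1 + t + ‖x‖) ^ α :=
    Real.rpow_le_rpow h1t.le (by linarith [norm_nonneg x]) hα0
  have h2 : (1 : ℝ) ≤ (1 + t) ^ (-α) * (1 + t + ‖x‖) ^ α := by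
    rw [Real.rpow_neg h1t.le, ← div_eq_inv_mul, one_le_div (by positivity)]
    exact h1
  calc ‖φ (ChernSimonsHiggs.event t x)‖ ^ (p + 1)
      ≤ ‖φ (ChernSimonsHiggs.event t x)‖ ^ (p + 1) *
        ((1 + t) ^ (-α) * (1 + t + ‖x‖) ^ α) := le_mul_of_one_le_right (by positivity) h2
    _ = _ := by ring
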